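/- **Channels.** A binary-input discrete memoryless channel $W$ has transition probabilities $W(y\mid x)$, $x\in\{0,1\}$, $y\in\mathcal Y$, where $W(\cdot\mid 0)$ and $W(\cdot\mid 1)$ are discrete probability distributions on $\mathcal Y$. It is *symmetric* (a BMS channel) if there is an involution $\sigma$ of $\mathcal Y$ with $W(y\mid 1)=W(\sigma(y)\mid 0)$ for all $y$. Let $$I(W)=\sum_{y}\sum_{x\in\{0,1\}}\tfrac12 W(y|x)\log_2\frac{W(y|x)}{\frac12W(y|0)+\frac12W(y|1)},\qquad Z(W)=\sum_y\sqrt{W(y|0)W(y|1)} ,$$ and for two channels $W_1,W_2$ define $$(W_1\boxplus W_2)(y_1,y_2|u_1)=\tfrac12\sum_{u_2}W_1(y_1|u_1\oplus u_2)W_2(y_2|u_2),\qquad (W_1\circledast W_2)(y_1,y_2,u_1|u_2)=\tfrac12W_1(y_1|u_1\oplus u_2)W_2(y_2|u_2).$$ **Polar codes.** An $n$-level polarization scheme for a block of $N=2^n$ channels does nothing if $n=0$. If $n\ge1$, it permutes the block by a permutation, groups the result into $N/2$ consecutive pairs and, for each pair $(W',W'')$, either produces $(W'\boxplus W'',\,W'\circledast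 W'')$ or skips the operation and keeps $(W',W'')$; the first channels of the results form one sub-block of length $N/2$, the second channels form another, and each sub-block is treated by its own $(n-1)$-level scheme. The permutations and the skipped pairs may be chosen freely. The outcome is a sequence of $N$ bit-channels (first sub-block before second). Correspondingly, a vector of bit-channel inputs is encoded recursively: if the inputs of the two channels produced from a pair are $v_0,v_1$, then the inputs of the pair are $v_0\oplus v_1,\,v_1$ (or $v_0,\,v_1$ if the operation is skipped). A *polar code* of length $N$ for the channels $W_1,\dots,W_N$ is given by an $n$-level scheme and a set $A$ of positions such that every bit-channel in $A$ has Bhattacharyya parameter $Z$ at most that of every bit-channel outside $A$; positions outside $A$ are frozen to $0$, positions in $A$ carry the message, and the rate is $|A|/N$. Its *successive cancellation (SC) decoder* estimates the bits in increasing order of position: a frozen bit is estimated as $0$, and a bit in $A$ is estimated as the more likely input of its bit-channel ($0$ in case of a tie), given the output of this bit-channel formed from the received symbols and the previous estimates. The block error probability is the probability that the estimate differs from the transmitted vector, for a uniformly random message, when the $j$-th code bit is sent over $W_j$ and the channels act independently. The decoder runs in time $t$ if a straight-line program with at most $t$ elementary instructions on real registers (rational constants, $+$, $-$, $\times$, $\div$,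 comparison of two registers) computes all the bit estimates from the likelihoods $W_j(y_j|0),W_j(y_j|1)$, $1\le j\le N$, of the received symbols. **Theorem.** Let $\{W_j\}_{j=1}^\infty$ be a (non-stationary) sequence of independent BMS channels such that the average capacity $$\overline I=\lim_{N\to\infty}\frac1N\sum_{j=1}^N I(W_j)$$ exists. Then there is a sequence $\{\mathcal C_i\}$ of polar codes, where $\mathcal C_i$ has length $N_i=2^{n_i}$ and is a polar code for $W_1,\dots,W_{N_i}$, with $n_i\to\infty$, such that the SC decoder of $\mathcal C_i$ runs in time $O(N_i\log N_i)$, the rates $R_i$ of $\mathcal C_i$ satisfy $\lim_{i\to\infty}R_i=\overline I$, and the block error probabilities $P_i$ of $\mathcal C_i$ under SC decoding, when the $j$-th bit of $\mathcal C_i$ is transmitted over $W_j$ for $1\le j\le N_i$, satisfy $\lim_{i\to\infty}P_i=0$. -/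

import Mathlib

open Filter Topology
open scoped ENNReal

universe u

noncomputable section

/-! ### Binary-input channels -/

/-- A binary-input discrete memoryless channel: `W.law x` is the distribution of the output
when the bit `x` is sent, i.e. `W.law x y` is the transition probability `W(y | x)`. -/
structure BinaryChannel : Type (u + 1) where
  /-- the output alphabet -/
  Out : Type u
  /-- the transition probabilities -/
  law : ZMod 2 → PMF Out

namespace BinaryChannel

/-- The real number `W(y | x)`. -/
def prob (W : BinaryChannel.{u}) (y : W.Out) (x : ZMod 2) : ℝ := (W.law x y).toReal

/-- A channel is symmetric (a BMS channel) if some involution `σ` of the output alphabet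
exchanges the two conditional laws: `W(y | 1) = W(σ y | 0)`. -/
def IsSymmetric (W : BinaryChannel.{u}) : Prop :=
  ∃ σ : W.Out → W.Out, Function.Involutive σ ∧ ∀ y, W.law 1 y = W.law 0 (σ y)

/-- The symmetric capacity
`I(W) = ∑_y ∑_x ½ W(y|x) log₂ (W(y|x) / (½ W(y|0) + ½ W(y|1)))`, in bits. -/
def symmetricCapacity (W : BinaryChannel.{u}) : ℝ :=
  ∑' y, ∑ x : ZMod 2, 1 / 2 * W.prob y x *
    Real.logb 2 (W.prob y x / (1 / 2 * W.prob y 0 + 1 / 2 * W.prob y 1))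

/-- The Bhattacharyya parameter `Z(W) = ∑_y √(W(y|0) W(y|1))`. -/
def bhattacharyya (W : BinaryChannel.{u}) : ℝ :=
  ∑' y, Real.sqrt (W.prob y 0 * W.prob y 1)

/-- The channel `W₁ ⊞ W₂`: the bit `u₁` is the input, `u₂` is a uniform bit,
`u₁ ⊕ u₂` is sent over `W₁`, `u₂` is sent over `W₂`, and the output is `(y₁, y₂)`. -/
def minus (W₁ W₂ : BinaryChannel.{u}) : BinaryChannel.{u} where
  Out := W₁.Out × W₂.Out
  law u₁ := (PMF.uniformOfFintype (ZMod 2)).bind fun u₂ =>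
    (W₁.law (u₁ + u₂)).bind fun y₁ => (W₂.law u₂).bind fun y₂ => PMF.pure (y₁, y₂)

/-- The channel `W₁ ⊛ W₂`: the bit `u₂` is the input, `u₁` is a uniform bit,
`u₁ ⊕ u₂` is sent over `W₁`, `u₂` is sent over `W₂`, and the output is `(y₁, y₂, u₁)`. -/
def plus (W₁ W₂ : BinaryChannel.{u}) : BinaryChannel.{u} where
  Out := W₁.Out × W₂.Out × ZMod 2
  law u₂ := (PMF.uniformOfFintype (ZMod 2)).bind fun u₁ =>
    (W₁.law (u₁ + u₂)).bind fun y₁ => (W₂.law u₂).bind fun y₂ => PMF.pure (y₁, y₂, u₁)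

/-- `(W₁ ⊞ W₂)(y₁, y₂ | u₁) = ½ ∑_{u₂} W₁(y₁ | u₁ ⊕ u₂) W₂(y₂ | u₂)`. -/
theorem minus_law (W₁ W₂ : BinaryChannel.{u}) (u₁ : ZMod 2) (y₁ : W₁.Out) (y₂ : W₂.Out) :
    (minus W₁ W₂).law u₁ (y₁, y₂) =
      2⁻¹ * ∑ u₂ : ZMod 2, W₁.law (u₁ + u₂) y₁ * W₂.law u₂ y₂ := by
  have key : ∀ u₂ : ZMod 2, ((W₁.law (u₁ + u₂)).bind fun z₁ => (W₂.law u₂).bind fun z₂ =>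
      PMF.pure (z₁, z₂)) (y₁, y₂) = W₁.law (u₁ + u₂) y₁ * W₂.law u₂ y₂ := by
    intro u₂
    rw [PMF.bind_apply, tsum_eq_single y₁]
    · rw [PMF.bind_apply, tsum_eq_single y₂]
      · simp
      · intro z hz
        simp [Ne.symm hz]
    · intro z hz
      simp [PMF.bind_apply, Ne.symm hz]
  refine (PMF.bind_apply (PMF.uniformOfFintype (ZMod 2)) _ (y₁, y₂)).trans ?_
  rw [tsum_fintype, Finset.mul_sum]
  refine Finset.sum_congr rfl fun u₂ _ => ?_
  rw [key u₂]
  simp [ZMod.card]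

/-- `(W₁ ⊛ W₂)(y₁, y₂, u₁ | u₂) = ½ W₁(y₁ | u₁ ⊕ u₂) W₂(y₂ | u₂)`. -/
theorem plus_law (W₁ W₂ : BinaryChannel.{u}) (u₁ u₂ : ZMod 2) (y₁ : W₁.Out) (y₂ : W₂.Out) :
    (plus W₁ W₂).law u₂ (y₁, y₂, u₁) =
      2⁻¹ * (W₁.law (u₁ + u₂) y₁ * W₂.law u₂ y₂) := by
  have key : ∀ v : ZMod 2, ((W₁.law (v + u₂)).bind fun z₁ => (W₂.law u₂).bind fun z₂ =>
      PMF.pure (z₁, z₂, v)) (y₁, y₂, u₁) =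
        if v = u₁ then W₁.law (u₁ + u₂) y₁ * W₂.law u₂ y₂ else 0 := by
    intro v
    split_ifs with hv
    · subst hv
      rw [PMF.bind_apply, tsum_eq_single y₁]
      · rw [PMF.bind_apply, tsum_eq_single y₂]
        · simp
        · intro z hz
          simp [Ne.symm hz]
      · intro z hz
        simp [PMF.bind_apply, Ne.symm hz]
    · simp [PMF.bind_apply, Ne.symm hv]
  refine (PMF.bind_apply (PMF.uniformOfFintype (ZMod 2)) _ (y₁, y₂, u₁)).trans ?_
  rw [tsum_fintype, Finset.sum_eq_single u₁]
  · rw [key u₁]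
    simp [ZMod.card]
  · intro v _ hv
    rw [key v, if_neg hv, mul_zero]
  · simp

/-- The first of the two channels produced from the pair `(W₁, W₂)`: it is `W₁ ⊞ W₂`, or `W₁`
itself if the combining operation is skipped. -/
def first (skip : Bool) (W₁ W₂ : BinaryChannel.{u}) : BinaryChannel.{u} :=
  match skip with
  | true => W₁
  | false => minus W₁ W₂

/-- The second of the two channels produced from the pair `(W₁, W₂)`: it is `W₁ ⊛ W₂`, or `W₂`
itself if the combining operation is skipped. -/
def second (skip : Bool) (W₁ W₂ : BinaryChannel.{u}) : BinaryChannel.{u} :=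
  match skip with
  | true => W₂
  | false => plus W₁ W₂

/-- The output of `first skip W₁ W₂` when `y₁`, `y₂` are the outputs of `W₁`, `W₂`. -/
def firstOut (skip : Bool) {W₁ W₂ : BinaryChannel.{u}} (y₁ : W₁.Out) (y₂ : W₂.Out) :
    (first skip W₁ W₂).Out :=
  match skip with
  | true => y₁
  | false => (y₁, y₂)

/-- The output of `second skip W₁ W₂` when `y₁`, `y₂` are the outputs of `W₁`, `W₂` and the input
of the first channel is (believed to be) `u₁`. -/
def secondOut (skip : Bool) {W₁ W₂ : BinaryChannel.{u}} (y₁ : W₁.Out) (y₂ : W₂.Out)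
    (u₁ : ZMod 2) : (second skip W₁ W₂).Out :=
  match skip with
  | true => y₂
  | false => (y₁, y₂, u₁)

end BinaryChannel

/-! ### Positions in a block of length `2 ^ n` (counted from `0`) -/

/-- Position `2 i` of a block of length `2 ^ (n + 1)`. -/
def evenPos {n : ℕ} (i : Fin (2 ^ n)) : Fin (2 ^ (n + 1)) :=
  ⟨2 * i, by have := i.isLt; rw [pow_succ]; omega⟩

/-- Position `2 i + 1` of a block of length `2 ^ (n + 1)`. -/
def oddPos {n : ℕ} (i : Fin (2 ^ n)) : Fin (2 ^ (n + 1)) :=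
  ⟨2 * i + 1, by have := i.isLt; rw [pow_succ]; omega⟩

/-- Position `i` in the first half of a block of length `2 ^ (n + 1)`. -/
def lowPos {n : ℕ} (i : Fin (2 ^ n)) : Fin (2 ^ (n + 1)) :=
  ⟨i, by have := i.isLt; rw [pow_succ]; omega⟩

/-- Position `i` in the second half of a block of length `2 ^ (n + 1)`. -/
def highPos {n : ℕ} (i : Fin (2 ^ n)) : Fin (2 ^ (n + 1)) :=
  ⟨2 ^ n + i, by have := i.isLt; rw [pow_succ]; omega⟩

/-- The block whose first half is `a` and whose second half is `b`. -/
def joinHalves {α : Type*} {n : ℕ} (a b : Fin (2 ^ n) → α) (i : Fin (2 ^ (n + 1))) : α :=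
  if h : i.val < 2 ^ n then a ⟨i, h⟩
  else b ⟨i - 2 ^ n, by have h' := i.isLt; have e := pow_succ 2 n; omega⟩

/-- The block whose entries at the positions `2 i` and `2 i + 1` are `a i` and `b i`. -/
def interleave {α : Type*} {n : ℕ} (a b : Fin (2 ^ n) → α) (k : Fin (2 ^ (n + 1))) : α :=
  have h : k.val / 2 < 2 ^ n := by have h' := k.isLt; have e := pow_succ 2 n; omega
  if k.val % 2 = 0 then a ⟨k / 2, h⟩ else b ⟨k / 2, h⟩

/-! ### Polarization with permutations and skipped operations -/

/-- The data of an `n`-level polarization of a block of `2 ^ n` channels: every sub-block is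
permuted by `π`, its entries are then combined in the consecutive pairs `(2 i, 2 i + 1)`, except
where `skip i` is true, and the first (`⊞`) and second (`⊛`) channels of the pairs form two
sub-blocks of half the length, which are treated in the same way, each with its own data. -/
inductive PolarScheme : ℕ → Type
  | leaf : PolarScheme 0
  | node {n : ℕ} (π : Equiv.Perm (Fin (2 ^ (n + 1)))) (skip : Fin (2 ^ n) → Bool)
      (s₀ s₁ : PolarScheme n) : PolarScheme (n + 1)

/-- The sub-block of the first channels of the pairs. -/
def firstBlock {n : ℕ} (π : Equiv.Perm (Fin (2 ^ (n + 1)))) (skip : Fin (2 ^ n) → Bool)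
    (W : Fin (2 ^ (n + 1)) → BinaryChannel.{u}) (i : Fin (2 ^ n)) : BinaryChannel.{u} :=
  .first (skip i) (W (π (evenPos i))) (W (π (oddPos i)))

/-- The sub-block of the second channels of the pairs. -/
def secondBlock {n : ℕ} (π : Equiv.Perm (Fin (2 ^ (n + 1)))) (skip : Fin (2 ^ n) → Bool)
    (W : Fin (2 ^ (n + 1)) → BinaryChannel.{u}) (i : Fin (2 ^ n)) : BinaryChannel.{u} :=
  .second (skip i) (W (π (evenPos i))) (W (π (oddPos i)))

namespace PolarScheme

/-- The bit-channels after all `n` levels of polarization of the block `W`. -/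
def bitChannel : {n : ℕ} → PolarScheme n → (Fin (2 ^ n) → BinaryChannel.{u}) →
    Fin (2 ^ n) → BinaryChannel.{u}
  | _, leaf, W => W
  | _, node π skip s₀ s₁, W =>
      joinHalves (s₀.bitChannel (firstBlock π skip W)) (s₁.bitChannel (secondBlock π skip W))

/-- The encoder: it turns the inputs `u` of the bit-channels into the bits sent over the original
channels. Where the inputs of the two channels produced from a pair are `v₀` and `v₁`, the inputs
of the pair are `v₀ ⊕ v₁` and `v₁`, or `v₀` and `v₁` if the operation is skipped. -/
def encode : {n : ℕ} → PolarScheme n → (Fin (2 ^ n) → ZMod 2) → Fin (2 ^ n) → ZMod 2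
  | _, leaf, u => u
  | _, node π skip s₀ s₁, u =>
      let v₀ := s₀.encode fun i => u (lowPos i)
      let v₁ := s₁.encode fun i => u (highPos i)
      fun k => interleave (fun i => if skip i then v₀ i else v₀ i + v₁ i) v₁ (π.symm k)

open Classical in
/-- Successive cancellation decoding. `A` is the set of information positions; all other positions
are frozen to `0`. The bits are estimated in increasing order of their position: the estimate at
an information position is the more likely input of its bit-channel (`0` in case of a tie), given
the output of that bit-channel formed from the channel outputs `y` and the previous estimates. -/
def scDecode : {n : ℕ} → PolarScheme n → Set (Fin (2 ^ n)) →
    (W : Fin (2 ^ n) → BinaryChannel.{u}) → ((j : Fin (2 ^ n)) → (W j).Out) →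
    Fin (2 ^ n) → ZMod 2
  | _, leaf, A, W, y => fun i =>
      if i ∈ A ∧ (W i).law 0 (y i) < (W i).law 1 (y i) then 1 else 0
  | _, node π skip s₀ s₁, A, W, y =>
      let û₀ := s₀.scDecode {i | lowPos i ∈ A} (firstBlock π skip W)
        fun i => BinaryChannel.firstOut (skip i) (y (π (evenPos i))) (y (π (oddPos i)))
      let v₀ := s₀.encode û₀
      let û₁ := s₁.scDecode {i | highPos i ∈ A} (secondBlock π skip W)
        fun i => BinaryChannel.secondOut (skip i) (y (π (evenPos i))) (y (π (oddPos i))) (v₀ i)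
      joinHalves û₀ û₁

end PolarScheme

/-! ### Running time: straight-line programs over the reals -/

/-- One elementary operation on real registers. -/
inductive RealOp : Type
  | const (c : ℚ)
  | add (a b : ℕ)
  | sub (a b : ℕ)
  | mul (a b : ℕ)
  | div (a b : ℕ)
  | less (a b : ℕ)

open Classical in
/-- The value computed by an operation; `less a b` is the comparison of two registers. -/
def RealOp.eval (r : ℕ → ℝ) : RealOp → ℝ
  | const c => c
  | add a b => r a + r b
  | sub a b => r a - r b
  | mul a b => r a * r b
  | div a b => r a / r b
  | less a b => if r a < r b then 1 else 0

/-- A program is a list of instructions `(d, op)`: store the value of `op` in register `d`. Every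
instruction takes one unit of time, so that the running time is the length of the list. -/
abbrev RealProgram : Type := List (ℕ × RealOp)

/-- The contents of the registers after a program has been run. -/
def RealProgram.run (p : RealProgram) (r : ℕ → ℝ) : ℕ → ℝ :=
  p.foldl (fun r c => Function.update r c.1 (c.2.eval r)) r

/-- The registers before decoding: registers `2 j` and `2 j + 1` hold the likelihoods
`W_j(y_j | 0)` and `W_j(y_j | 1)` of the received symbols, all other registers hold `0`. -/
def likelihoodRegisters {N : ℕ} (W : Fin N → BinaryChannel.{u}) (y : (j : Fin N) → (W j).Out)
    (k : ℕ) : ℝ :=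
  if h : k / 2 < N then (W ⟨k / 2, h⟩).prob (y ⟨k / 2, h⟩) (k : ZMod 2) else 0

/-! ### Polar codes -/

/-- A polar code of length `2 ^ n` for the channels `W`: a polarization scheme, together with a set
of information positions whose bit-channels are at least as reliable (in terms of their
Bhattacharyya parameters) as all the others. The other positions are frozen to `0`. -/
structure PolarCode {n : ℕ} (W : Fin (2 ^ n) → BinaryChannel.{u}) where
  scheme : PolarScheme n
  info : Finset (Fin (2 ^ n))
  info_best : ∀ i ∈ info, ∀ j ∉ info,
    (scheme.bitChannel W i).bhattacharyya ≤ (scheme.bitChannel W j).bhattacharyya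

namespace PolarCode

variable {n : ℕ} {W : Fin (2 ^ n) → BinaryChannel.{u}}

/-- The rate of the code. -/
def rate (C : PolarCode W) : ℝ := (C.info.card : ℝ) / 2 ^ n

/-- The messages: the bit vectors which vanish at the frozen positions. -/
def messages (C : PolarCode W) : Finset (Fin (2 ^ n) → ZMod 2) :=
  {m | ∀ i, i ∉ C.info → m i = 0}

/-- The successive cancellation decoder of the code. -/
def decode (C : PolarCode W) (y : (j : Fin (2 ^ n)) → (W j).Out) : Fin (2 ^ n) → ZMod 2 :=
  C.scheme.scDecode (C.info : Set (Fin (2 ^ n))) W y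

open Classical in
/-- The probability of block error under successive cancellation decoding, for a uniformly random
message, when the `j`-th code bit is sent over `W j` and the channels are independent. -/
def blockError (C : PolarCode W) : ℝ≥0∞ :=
  (∑ m ∈ C.messages, ∑' y : (j : Fin (2 ^ n)) → (W j).Out,
    if C.decode y = m then 0 else ∏ j, (W j).law (C.scheme.encode m j) (y j)) /
      (C.messages.card : ℝ≥0∞)

/-- The successive cancellation decoder can be carried out in at most `t` elementary operations:
a program of length at most `t` computes all the bit estimates from the likelihoods of the
received symbols. -/
def DecodableIn (C : PolarCode W) (t : ℕ) : Prop :=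
  ∃ (p : RealProgram) (out : Fin (2 ^ n) → ℕ), p.length ≤ t ∧
    ∀ y i, p.run (likelihoodRegisters W y) (out i) = if C.decode y i = 1 then 1 else 0

end PolarCode

end

noncomputable section

/-! ### Sums over two-element types and product alphabets -/

/-! Polarizing a pair preserves the sum of the capacities (`symmetricCapacity_minus_add_plus`), and
I ≤ 1 as well as I ≤ (2 / log 2)(1 - Z). So if the `loss` of a scheme, the sum of 1 - Z over the
bit-channels with Z > τ, is o(N), then the number of bit-channels with Z ≤ τ is at least the total
capacity up to o(N) (`sum_symmetricCapacity_le`). The block error is at most the sum of Z over the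
information positions (`blockError_le`), hence at most N τ. Everything reduces to a scheme with
small loss and small N τ for every long block, whatever its channels are (`exists_loss_le_mul`).

The scheme has three phases. (1) `exists_loss_le`: sort the block by Z and polarize neighbours. The
potential ∑ (2Z - Z²) falls by at least ∑ (Z(1 - Z))² minus 1, since neighbours in sorted order
differ by at most 1 in total. It cannot keep falling by a sizeable fraction, so in boundedly many
levels few channels have Z away from 0 and 1. (2) `exists_loss_le_of_sorted`: bisect the sorted
block with skipped operations, which separates nearly perfect channels from the rest; the rest are
left alone. (3) `exists_loss_le_of_reliable`: with Z ≤ x⁴, the two operations send x to 1.2 x and x²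
at most, of mean at most 0.7 x for small x. So x decays exponentially on average, and Z reaches
0.7^(4 m), which beats 2^(-m).

For the error bound, symmetry makes the failure probability independent of the transmitted vector
(`failure_add`), so it equals its average over all vectors, frozen bits included. Under uniform
inputs every sub-block sees exactly its synthetic channels, and a union bound runs through the
recursion (`sum_failure_le`). For the running time, decoded bits and their re-encoding are computed
together, with a bounded number of operations per pair and level (`computes_scDecode`). -/

theorem sum_zmod_two {M : Type*} [AddCommMonoid M] (f : ZMod 2 → M) :
    ∑ x, f x = f 0 + f 1 :=
  Fin.sum_univ_two f

theorem zmod_two_add_self (x : ZMod 2) : x + x = 0 := CharTwo.add_self_eq_zero x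

theorem zmod_two_eq_zero_or_one (x : ZMod 2) : x = 0 ∨ x = 1 := by
  revert x; decide

theorem hasSum_prod_zmod_two {A B : Type*} {f : A × B × ZMod 2 → ℝ} {s t : ℝ}
    (h₀ : HasSum (fun p : A × B => f (p.1, p.2, 0)) s)
    (h₁ : HasSum (fun p : A × B => f (p.1, p.2, 1)) t) : HasSum f (s + t) := by
  have key : ∀ (v : ZMod 2) {r : ℝ}, HasSum (fun p : A × B => f (p.1, p.2, v)) r →
      HasSum (fun p : A × B × ZMod 2 => if p.2.2 = v then f p else 0) r := by
    intro v r h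
    have hinj : Function.Injective (fun p : A × B => (p.1, p.2, v)) := by
      rintro ⟨a, b⟩ ⟨c, d⟩ h
      simpa using h
    rw [← hinj.hasSum_iff]
    · simpa [Function.comp_def] using h
    · rintro ⟨a, b, w⟩ hw
      have : w ≠ v := by
        rintro rfl
        exact hw ⟨(a, b), rfl⟩
      simp [this]
  refine ((key 0 h₀).add (key 1 h₁)).congr_fun fun p => ?_
  rcases zmod_two_eq_zero_or_one p.2.2 with h | h <;> simp [h]

theorem HasSum.mul_prod_of_nonneg {A B : Type*} {f : A → ℝ} {g : B → ℝ} {s t : ℝ}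
    (hf : HasSum f s) (hg : HasSum g t) (hf0 : ∀ a, 0 ≤ f a) (hg0 : ∀ b, 0 ≤ g b) :
    HasSum (fun p : A × B => f p.1 * g p.2) (s * t) :=
  hf.mul hg (hf.summable.mul_of_nonneg hg.summable hf0 hg0)

/-! ### The contribution of one output symbol to the capacity -/

/-- The contribution to the symmetric capacity of an output symbol with likelihoods `a`, `b`. -/
def capacityTerm (a b : ℝ) : ℝ :=
  1 / 2 * a * Real.logb 2 (a / (1 / 2 * a + 1 / 2 * b)) +
    1 / 2 * b * Real.logb 2 (b / (1 / 2 * a + 1 / 2 * b))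

/-- In the application `m` is the mean of `a` and another nonnegative number; `hm` makes `m`
positive as soon as `a` is. -/
theorem mul_log_div_eq {a m : ℝ} (ha : 0 ≤ a) (hm : a ≤ 2 * m) :
    a * Real.log (a / m) = a * Real.log m * (-1) - Real.negMulLog a := by
  rcases ha.eq_or_lt with rfl | ha
  · simp
  · rw [Real.log_div ha.ne' (by linarith), Real.negMulLog]
    ring

/-- As a Jensen gap of `Real.negMulLog`, the term is accessible to the product rule
`Real.negMulLog_mul`, which turns the chain rule into algebra. -/
theorem capacityTerm_eq {a b : ℝ} (ha : 0 ≤ a) (hb : 0 ≤ b) :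
    capacityTerm a b = (Real.negMulLog ((a + b) / 2) -
      (Real.negMulLog a + Real.negMulLog b) / 2) / Real.log 2 := by
  have h1 := mul_log_div_eq ha (m := (1 / 2 * a + 1 / 2 * b)) (by linarith)
  have h2 := mul_log_div_eq hb (m := (1 / 2 * a + 1 / 2 * b)) (by linarith)
  have e : (a + b) / 2 = 1 / 2 * a + 1 / 2 * b := by ring
  have : capacityTerm a b = (1 / 2 * (a * Real.log (a / (1 / 2 * a + 1 / 2 * b))) +
      1 / 2 * (b * Real.log (b / (1 / 2 * a + 1 / 2 * b)))) / Real.log 2 := by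
    simp only [capacityTerm, Real.logb]; ring
  rw [this, h1, h2, e]
  congr 1
  simp only [Real.negMulLog]
  ring

theorem capacityTerm_le_half_add {a b : ℝ} (ha : 0 ≤ a) (hb : 0 ≤ b) :
    capacityTerm a b ≤ (a + b) / 2 := by
  have key : ∀ c m : ℝ, 0 ≤ c → c ≤ 2 * m → c * Real.logb 2 (c / m) ≤ c := by
    intro c m hc hm
    rcases hc.eq_or_lt with rfl | hc
    · simp
    · have hm' : 0 < m := by linarith
      have : Real.logb 2 (c / m) ≤ 1 := by
        rw [Real.logb_le_iff_le_rpow one_lt_two (by positivity)]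
        rw [Real.rpow_one, div_le_iff₀ hm']
        exact hm
      nlinarith
  have h1 := key a (1 / 2 * a + 1 / 2 * b) ha (by linarith)
  have h2 := key b (1 / 2 * a + 1 / 2 * b) hb (by linarith)
  unfold capacityTerm
  linarith

theorem capacityTerm_nonneg {a b : ℝ} (ha : 0 ≤ a) (hb : 0 ≤ b) : 0 ≤ capacityTerm a b := by
  have key : ∀ c m : ℝ, 0 ≤ c → c ≤ 2 * m → c - m ≤ c * Real.log (c / m) := by
    intro c m hc hm
    rcases hc.eq_or_lt with rfl | hc
    · simp; linarith
    · have hm' : 0 < m := by linarith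
      have := Real.one_sub_inv_le_log_of_pos (x := c / m) (by positivity)
      have h3 := mul_le_mul_of_nonneg_left this hc.le
      have : c * (1 - (c / m)⁻¹) = c - m := by field_simp
      linarith
  have h1 := key a (1 / 2 * a + 1 / 2 * b) ha (by linarith)
  have h2 := key b (1 / 2 * a + 1 / 2 * b) hb (by linarith)
  have : capacityTerm a b = (1 / 2 * (a * Real.log (a / (1 / 2 * a + 1 / 2 * b))) +
      1 / 2 * (b * Real.log (b / (1 / 2 * a + 1 / 2 * b)))) / Real.log 2 := by
    simp only [capacityTerm, Real.logb]; ring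
  rw [this]
  exact div_nonneg (by linarith) (Real.log_pos one_lt_two).le

/-- The bound log r ≤ r - 1 gives (a - b)² / (2 (a + b)). With a = s² and b = t² this is at most (s
- t)², because (s + t)² ≤ 2 (s² + t²). -/
theorem capacityTerm_le_sub_sqrt {a b : ℝ} (ha : 0 ≤ a) (hb : 0 ≤ b) :
    capacityTerm a b ≤ 2 / Real.log 2 * ((a + b) / 2 - Real.sqrt (a * b)) := by
  have hl := Real.log_pos one_lt_two
  rcases (add_nonneg ha hb).eq_or_lt with h0 | h0
  · obtain rfl : a = 0 := by linarith
    obtain rfl : b = 0 := by linarith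
    simp [capacityTerm]
  have hm : 0 < 1 / 2 * a + 1 / 2 * b := by linarith
  have key : ∀ c : ℝ, 0 ≤ c → c * Real.log (c / (1 / 2 * a + 1 / 2 * b)) ≤
      c * (c / (1 / 2 * a + 1 / 2 * b) - 1) := by
    intro c hc
    rcases hc.eq_or_lt with rfl | hc
    · simp
    · exact mul_le_mul_of_nonneg_left (Real.log_le_sub_one_of_pos (by positivity)) hc.le
  have h1 := key a ha
  have h2 := key b hb
  have e : capacityTerm a b = (1 / 2 * (a * Real.log (a / (1 / 2 * a + 1 / 2 * b))) +
      1 / 2 * (b * Real.log (b / (1 / 2 * a + 1 / 2 * b)))) / Real.log 2 := by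
    simp only [capacityTerm, Real.logb]; ring
  have e2 : 1 / 2 * (a * (a / (1 / 2 * a + 1 / 2 * b) - 1)) +
      1 / 2 * (b * (b / (1 / 2 * a + 1 / 2 * b) - 1)) = (a - b) ^ 2 / (2 * (a + b)) := by
    field_simp
    ring
  have e3 : (a - b) ^ 2 / (2 * (a + b)) ≤ a + b - 2 * Real.sqrt (a * b) := by
    rw [div_le_iff₀ (by linarith), Real.sqrt_mul ha]
    obtain ⟨s, hs, rfl⟩ : ∃ s, 0 ≤ s ∧ a = s ^ 2 :=
      ⟨Real.sqrt a, Real.sqrt_nonneg _, (Real.sq_sqrt ha).symm⟩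
    obtain ⟨t, ht, rfl⟩ : ∃ t, 0 ≤ t ∧ b = t ^ 2 :=
      ⟨Real.sqrt b, Real.sqrt_nonneg _, (Real.sq_sqrt hb).symm⟩
    rw [Real.sqrt_sq hs, Real.sqrt_sq ht]
    have : 0 ≤ (s - t) ^ 2 * (s - t) ^ 2 := by positivity
    nlinarith
  rw [e, div_le_iff₀ hl]
  have e4 : 2 / Real.log 2 * ((a + b) / 2 - Real.sqrt (a * b)) * Real.log 2 =
      a + b - 2 * Real.sqrt (a * b) := by field_simp
  rw [e4]
  linarith

/-- The chain rule for one pair of output symbols. -/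
theorem capacityTerm_minus_add_plus {a b c d : ℝ} (ha : 0 ≤ a) (hb : 0 ≤ b) (hc : 0 ≤ c)
    (hd : 0 ≤ d) :
    capacityTerm (1 / 2 * (a * c + b * d)) (1 / 2 * (b * c + a * d)) +
      (capacityTerm (1 / 2 * (a * c)) (1 / 2 * (b * d)) +
        capacityTerm (1 / 2 * (b * c)) (1 / 2 * (a * d))) =
      capacityTerm a b * ((c + d) / 2) + (a + b) / 2 * capacityTerm c d := by
  rw [capacityTerm_eq (by positivity) (by positivity),
    capacityTerm_eq (by positivity) (by positivity),
    capacityTerm_eq (by positivity) (by positivity), capacityTerm_eq ha hb, capacityTerm_eq hc hd]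
  -- The means of the two plus pairs are half the likelihoods of the minus channel, so their entropy
  -- terms cancel the ones subtracted in the minus part.
  have e1 : (1 / 2 * (a * c + b * d) + 1 / 2 * (b * c + a * d)) / 2 =
    ((a + b) / 2) * ((c + d) / 2) := by ring
  have e2 : (1 / 2 * (a * c) + 1 / 2 * (b * d)) / 2 = 1 / 2 * (1 / 2 * (a * c + b * d)) := by ring
  have e3 : (1 / 2 * (b * c) + 1 / 2 * (a * d)) / 2 = 1 / 2 * (1 / 2 * (b * c + a * d)) := by ring
  rw [e1, e2, e3, Real.negMulLog_mul ((a + b) / 2), Real.negMulLog_mul _ (1 / 2 * (a * c + b * d)),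
    Real.negMulLog_mul _ (1 / 2 * (b * c + a * d)), Real.negMulLog_mul _ (a * c),
    Real.negMulLog_mul _ (b * d), Real.negMulLog_mul _ (b * c), Real.negMulLog_mul _ (a * d),
    Real.negMulLog_mul a c, Real.negMulLog_mul b d, Real.negMulLog_mul b c, Real.negMulLog_mul a d]
  ring

/-- Arıkan's estimate for one pair of output symbols. -/
theorem sqrt_minus_le {a b c d : ℝ} (ha : 0 ≤ a) (hb : 0 ≤ b) (hc : 0 ≤ c) (hd : 0 ≤ d) :
    Real.sqrt ((1 / 2 * (a * c + b * d)) * (1 / 2 * (b * c + a * d))) ≤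
      (a + b) / 2 * Real.sqrt (c * d) + Real.sqrt (a * b) * ((c + d) / 2) -
        Real.sqrt (a * b) * Real.sqrt (c * d) := by
  rw [Real.sqrt_mul ha, Real.sqrt_mul hc]
  obtain ⟨s, hs, rfl⟩ : ∃ s, 0 ≤ s ∧ a = s ^ 2 :=
    ⟨Real.sqrt a, Real.sqrt_nonneg _, (Real.sq_sqrt ha).symm⟩
  obtain ⟨t, ht, rfl⟩ : ∃ t, 0 ≤ t ∧ b = t ^ 2 :=
    ⟨Real.sqrt b, Real.sqrt_nonneg _, (Real.sq_sqrt hb).symm⟩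
  obtain ⟨p, hp, rfl⟩ : ∃ t, 0 ≤ t ∧ c = t ^ 2 :=
    ⟨Real.sqrt c, Real.sqrt_nonneg _, (Real.sq_sqrt hc).symm⟩
  obtain ⟨q, hq, rfl⟩ : ∃ t, 0 ≤ t ∧ d = t ^ 2 :=
    ⟨Real.sqrt d, Real.sqrt_nonneg _, (Real.sq_sqrt hd).symm⟩
  rw [Real.sqrt_sq hs, Real.sqrt_sq ht, Real.sqrt_sq hp, Real.sqrt_sq hq]
  refine Real.sqrt_le_iff.2 ⟨?_, ?_⟩
  · have h1 : 0 ≤ (s - t) ^ 2 * (p * q) := by positivity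
    have h2 : 0 ≤ (p - q) ^ 2 * (s * t) := by positivity
    have h3 : 0 ≤ s * t * (p * q) := by positivity
    nlinarith
  -- This product is four times the difference of the squares of the two sides.
  · have : 0 ≤ 2 * (s * t * p * q) * ((s - t) ^ 2 * (p - q) ^ 2) := by positivity
    nlinarith

namespace BinaryChannel

variable (W W₁ W₂ : BinaryChannel.{u})

/-! ### Transition probabilities -/

theorem prob_nonneg (y : W.Out) (x : ZMod 2) : 0 ≤ W.prob y x := ENNReal.toReal_nonneg

theorem hasSum_prob (x : ZMod 2) : HasSum (fun y => W.prob y x) 1 := by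
  have h := ENNReal.hasSum_toReal (f := fun y => W.law x y) (by simp [(W.law x).tsum_coe])
  rw [← ENNReal.tsum_toReal_eq (fun y => (W.law x).apply_ne_top y), (W.law x).tsum_coe] at h
  rw [ENNReal.toReal_one] at h
  exact h

theorem hasSum_half_add_prob : HasSum (fun y => (W.prob y 0 + W.prob y 1) / 2) 1 := by
  simpa using ((W.hasSum_prob 0).add (W.hasSum_prob 1)).div_const 2

theorem prob_minus_zero (y₁ : W₁.Out) (y₂ : W₂.Out) :
    (minus W₁ W₂).prob (y₁, y₂) 0 =
      1 / 2 * (W₁.prob y₁ 0 * W₂.prob y₂ 0 + W₁.prob y₁ 1 * W₂.prob y₂ 1) := by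
  have h := fun (W : BinaryChannel.{u}) x y => (W.law x).apply_ne_top y
  refine (congrArg ENNReal.toReal (minus_law W₁ W₂ 0 y₁ y₂)).trans ?_
  rw [sum_zmod_two, ENNReal.toReal_mul, ENNReal.toReal_add, ENNReal.toReal_mul,
    ENNReal.toReal_mul]
  · simp [prob]
  all_goals exact ENNReal.mul_ne_top (h _ _ _) (h _ _ _)

theorem prob_minus_one (y₁ : W₁.Out) (y₂ : W₂.Out) :
    (minus W₁ W₂).prob (y₁, y₂) 1 =
      1 / 2 * (W₁.prob y₁ 1 * W₂.prob y₂ 0 + W₁.prob y₁ 0 * W₂.prob y₂ 1) := by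
  have h := fun (W : BinaryChannel.{u}) x y => (W.law x).apply_ne_top y
  refine (congrArg ENNReal.toReal (minus_law W₁ W₂ 1 y₁ y₂)).trans ?_
  rw [sum_zmod_two, ENNReal.toReal_mul, ENNReal.toReal_add, ENNReal.toReal_mul,
    ENNReal.toReal_mul, zmod_two_add_self]
  · simp [prob]
  all_goals exact ENNReal.mul_ne_top (h _ _ _) (h _ _ _)

theorem prob_plus (y₁ : W₁.Out) (y₂ : W₂.Out) (u₁ u₂ : ZMod 2) :
    (plus W₁ W₂).prob (y₁, y₂, u₁) u₂ = 1 / 2 * (W₁.prob y₁ (u₁ + u₂) * W₂.prob y₂ u₂) := by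
  refine (congrArg ENNReal.toReal (plus_law W₁ W₂ u₁ u₂ y₁ y₂)).trans ?_
  rw [ENNReal.toReal_mul, ENNReal.toReal_mul]
  simp [prob]

/-! ### The Bhattacharyya parameter -/

theorem hasSum_bhattacharyya :
    HasSum (fun y => Real.sqrt (W.prob y 0 * W.prob y 1)) W.bhattacharyya := by
  refine (Summable.of_nonneg_of_le (fun _ => Real.sqrt_nonneg _) (fun y => ?_)
    W.hasSum_half_add_prob.summable).hasSum
  refine Real.sqrt_le_iff.2 ⟨by have := W.prob_nonneg y 0; have := W.prob_nonneg y 1; linarith, ?_⟩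
  nlinarith [sq_nonneg (W.prob y 0 - W.prob y 1)]

theorem bhattacharyya_nonneg : 0 ≤ W.bhattacharyya :=
  tsum_nonneg fun _ => Real.sqrt_nonneg _

theorem bhattacharyya_le_one : W.bhattacharyya ≤ 1 := by
  refine hasSum_le (fun y => ?_) W.hasSum_bhattacharyya W.hasSum_half_add_prob
  refine Real.sqrt_le_iff.2 ⟨by have := W.prob_nonneg y 0; have := W.prob_nonneg y 1; linarith, ?_⟩
  nlinarith [sq_nonneg (W.prob y 0 - W.prob y 1)]

/-- The output bit `u₁` only swaps the two likelihoods of `W₁`, so each of its values contributes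
half of the product. -/
theorem bhattacharyya_plus :
    (plus W₁ W₂).bhattacharyya = W₁.bhattacharyya * W₂.bhattacharyya := by
  have h := (W₁.hasSum_bhattacharyya.mul_prod_of_nonneg W₂.hasSum_bhattacharyya
    (fun _ => Real.sqrt_nonneg _) (fun _ => Real.sqrt_nonneg _)).div_const 2
  have e : ∀ (v : ZMod 2) (p : W₁.Out × W₂.Out),
      Real.sqrt ((plus W₁ W₂).prob (p.1, p.2, v) 0 * (plus W₁ W₂).prob (p.1, p.2, v) 1) =
      Real.sqrt (W₁.prob p.1 0 * W₁.prob p.1 1) * Real.sqrt (W₂.prob p.2 0 * W₂.prob p.2 1) / 2 := by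
    intro v p
    have e1 : (plus W₁ W₂).prob (p.1, p.2, v) 0 * (plus W₁ W₂).prob (p.1, p.2, v) 1 =
        (1 / 2) ^ 2 * ((W₁.prob p.1 0 * W₁.prob p.1 1) * (W₂.prob p.2 0 * W₂.prob p.2 1)) := by
      rw [prob_plus, prob_plus]
      rcases zmod_two_eq_zero_or_one v with rfl | rfl
      · simp only [zero_add]; ring
      · simp only [zmod_two_add_self, add_zero]; ring
    rw [e1, Real.sqrt_mul (by positivity), Real.sqrt_sq (by positivity), Real.sqrt_mul
      (mul_nonneg (W₁.prob_nonneg _ _) (W₁.prob_nonneg _ _))]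
    ring
  have h2 := hasSum_prod_zmod_two (A := W₁.Out) (B := W₂.Out)
    (f := fun y => Real.sqrt ((plus W₁ W₂).prob y 0 * (plus W₁ W₂).prob y 1))
    (h.congr_fun (e 0)) (h.congr_fun (e 1))
  rw [bhattacharyya]
  exact h2.tsum_eq.trans (by ring)

theorem bhattacharyya_minus_le :
    (minus W₁ W₂).bhattacharyya ≤ W₁.bhattacharyya + W₂.bhattacharyya -
      W₁.bhattacharyya * W₂.bhattacharyya := by
  have n₁ := W₁.prob_nonneg
  have n₂ := W₂.prob_nonneg
  have hq₁ : ∀ y, 0 ≤ (W₁.prob y 0 + W₁.prob y 1) / 2 := fun y => by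
    linarith [n₁ y 0, n₁ y 1]
  have hq₂ : ∀ y, 0 ≤ (W₂.prob y 0 + W₂.prob y 1) / 2 := fun y => by
    linarith [n₂ y 0, n₂ y 1]
  have h := ((W₁.hasSum_half_add_prob.mul_prod_of_nonneg W₂.hasSum_bhattacharyya hq₁
    (fun _ => Real.sqrt_nonneg _)).add (W₁.hasSum_bhattacharyya.mul_prod_of_nonneg
    W₂.hasSum_half_add_prob (fun _ => Real.sqrt_nonneg _) hq₂)).sub
    (W₁.hasSum_bhattacharyya.mul_prod_of_nonneg W₂.hasSum_bhattacharyya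
    (fun _ => Real.sqrt_nonneg _) (fun _ => Real.sqrt_nonneg _))
  have hm : HasSum (fun p : W₁.Out × W₂.Out => _) (minus W₁ W₂).bhattacharyya :=
    (minus W₁ W₂).hasSum_bhattacharyya
  refine (hasSum_le (fun p => ?_) hm h).trans (by linarith)
  have := sqrt_minus_le (n₁ p.1 0) (n₁ p.1 1) (n₂ p.2 0) (n₂ p.2 1)
  rw [← prob_minus_zero, ← prob_minus_one] at this
  exact this

/-! ### The symmetric capacity -/

theorem hasSum_symmetricCapacity :
    HasSum (fun y => capacityTerm (W.prob y 0) (W.prob y 1)) W.symmetricCapacity := by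
  have e : W.symmetricCapacity = ∑' y, capacityTerm (W.prob y 0) (W.prob y 1) := by
    simp only [symmetricCapacity, sum_zmod_two, capacityTerm]
  rw [e]
  exact (Summable.of_nonneg_of_le
    (fun y => capacityTerm_nonneg (W.prob_nonneg _ _) (W.prob_nonneg _ _))
    (fun y => capacityTerm_le_half_add (W.prob_nonneg _ _) (W.prob_nonneg _ _))
    W.hasSum_half_add_prob.summable).hasSum

theorem symmetricCapacity_nonneg : 0 ≤ W.symmetricCapacity :=
  W.hasSum_symmetricCapacity.nonneg
    fun _ => capacityTerm_nonneg (W.prob_nonneg _ _) (W.prob_nonneg _ _)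

theorem symmetricCapacity_le_one : W.symmetricCapacity ≤ 1 :=
  hasSum_le (fun _ => capacityTerm_le_half_add (W.prob_nonneg _ _) (W.prob_nonneg _ _))
    W.hasSum_symmetricCapacity W.hasSum_half_add_prob

theorem symmetricCapacity_le_one_sub_bhattacharyya :
    W.symmetricCapacity ≤ 2 / Real.log 2 * (1 - W.bhattacharyya) :=
  hasSum_le (fun _ => capacityTerm_le_sub_sqrt (W.prob_nonneg _ _) (W.prob_nonneg _ _))
    W.hasSum_symmetricCapacity
    ((W.hasSum_half_add_prob.sub W.hasSum_bhattacharyya).mul_left _)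

/-- The chain rule: polarization of a pair preserves the sum of the capacities. -/
theorem symmetricCapacity_minus_add_plus :
    (minus W₁ W₂).symmetricCapacity + (plus W₁ W₂).symmetricCapacity =
      W₁.symmetricCapacity + W₂.symmetricCapacity := by
  have n₁ := W₁.prob_nonneg
  have n₂ := W₂.prob_nonneg
  have c₁ := fun y => capacityTerm_nonneg (n₁ y 0) (n₁ y 1)
  have c₂ := fun y => capacityTerm_nonneg (n₂ y 0) (n₂ y 1)
  have hq₁ : ∀ y, 0 ≤ (W₁.prob y 0 + W₁.prob y 1) / 2 := fun y => by
    linarith [n₁ y 0, n₁ y 1]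
  have hq₂ : ∀ y, 0 ≤ (W₂.prob y 0 + W₂.prob y 1) / 2 := fun y => by
    linarith [n₂ y 0, n₂ y 1]
  have hR := (W₁.hasSum_symmetricCapacity.mul_prod_of_nonneg W₂.hasSum_half_add_prob c₁ hq₂).add
    (W₁.hasSum_half_add_prob.mul_prod_of_nonneg W₂.hasSum_symmetricCapacity hq₁ c₂)
  have hp := (plus W₁ W₂).hasSum_symmetricCapacity.summable
  have hs : ∀ v : ZMod 2, Summable fun p : W₁.Out × W₂.Out =>
      capacityTerm ((plus W₁ W₂).prob (p.1, p.2, v) 0) ((plus W₁ W₂).prob (p.1, p.2, v) 1) := by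
    intro v
    refine Summable.comp_injective (i := fun p : W₁.Out × W₂.Out => (p.1, p.2, v)) hp ?_
    rintro ⟨a, b⟩ ⟨c, d⟩ h
    simpa using h
  have hplus := (hasSum_prod_zmod_two (A := W₁.Out) (B := W₂.Out)
    (f := fun y => capacityTerm ((plus W₁ W₂).prob y 0) ((plus W₁ W₂).prob y 1))
    (hs 0).hasSum (hs 1).hasSum).unique (plus W₁ W₂).hasSum_symmetricCapacity
  rw [← hplus]
  have hm : HasSum (fun p : W₁.Out × W₂.Out => _) (minus W₁ W₂).symmetricCapacity :=
    (minus W₁ W₂).hasSum_symmetricCapacity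
  refine ((hm.add ((hs 0).hasSum.add (hs 1).hasSum)).congr_fun fun p => ?_).unique hR
    |>.trans (by ring)
  have e := capacityTerm_minus_add_plus (n₁ p.1 0) (n₁ p.1 1) (n₂ p.2 0) (n₂ p.2 1)
  rw [← prob_minus_zero, ← prob_minus_one] at e
  have e0 := fun v => prob_plus W₁ W₂ p.1 p.2 0 v
  have e1 := fun v => prob_plus W₁ W₂ p.1 p.2 1 v
  simp only [zero_add] at e0
  have e10 := e1 0
  have e11 := e1 1
  rw [add_zero] at e10
  rw [zmod_two_add_self] at e11
  rw [← e0, ← e0, ← e10, ← e11] at e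
  exact e.symm

end BinaryChannel

/-! ### Positions in a block -/

section Positions

variable {n : ℕ}

theorem evenPos_injective : Function.Injective (evenPos (n := n)) := by
  intro i j h
  simp only [evenPos, Fin.mk.injEq] at h
  exact Fin.ext (by omega)

theorem oddPos_injective : Function.Injective (oddPos (n := n)) := by
  intro i j h
  simp only [oddPos, Fin.mk.injEq] at h
  exact Fin.ext (by omega)

theorem evenPos_ne_oddPos (i j : Fin (2 ^ n)) : evenPos i ≠ oddPos j := by
  intro h
  simp only [evenPos, oddPos, Fin.mk.injEq] at h
  omega

theorem lowPos_injective : Function.Injective (lowPos (n := n)) := by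
  intro i j h
  simp only [lowPos, Fin.mk.injEq] at h
  exact Fin.ext h

theorem highPos_injective : Function.Injective (highPos (n := n)) := by
  intro i j h
  simp only [highPos, Fin.mk.injEq] at h
  exact Fin.ext (by omega)

theorem lowPos_lt_highPos (i j : Fin (2 ^ n)) : lowPos i < highPos j := by
  have := i.isLt
  simp only [lowPos, highPos, Fin.mk_lt_mk]
  omega

theorem card_fin_two_pow_sum :
    Fintype.card (Fin (2 ^ n) ⊕ Fin (2 ^ n)) = Fintype.card (Fin (2 ^ (n + 1))) := by
  simp [pow_succ, mul_two]

/-- The positions of a block, split into the even and the odd ones. -/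
def evenOddEquiv (n : ℕ) : Fin (2 ^ n) ⊕ Fin (2 ^ n) ≃ Fin (2 ^ (n + 1)) :=
  Equiv.ofBijective (Sum.elim evenPos oddPos) <|
    (Fintype.bijective_iff_injective_and_card _).2
      ⟨evenPos_injective.sumElim oddPos_injective evenPos_ne_oddPos, card_fin_two_pow_sum⟩

/-- The positions of a block, split into the two halves. -/
def lowHighEquiv (n : ℕ) : Fin (2 ^ n) ⊕ Fin (2 ^ n) ≃ Fin (2 ^ (n + 1)) :=
  Equiv.ofBijective (Sum.elim lowPos highPos) <|
    (Fintype.bijective_iff_injective_and_card _).2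
      ⟨lowPos_injective.sumElim highPos_injective fun i j => (lowPos_lt_highPos i j).ne,
        card_fin_two_pow_sum⟩

@[simp] theorem evenOddEquiv_inl (i : Fin (2 ^ n)) : evenOddEquiv n (.inl i) = evenPos i := rfl
@[simp] theorem evenOddEquiv_inr (i : Fin (2 ^ n)) : evenOddEquiv n (.inr i) = oddPos i := rfl
@[simp] theorem lowHighEquiv_inl (i : Fin (2 ^ n)) : lowHighEquiv n (.inl i) = lowPos i := rfl
@[simp] theorem lowHighEquiv_inr (i : Fin (2 ^ n)) : lowHighEquiv n (.inr i) = highPos i := rfl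

@[simp] theorem evenOddEquiv_symm_evenPos (i : Fin (2 ^ n)) :
    (evenOddEquiv n).symm (evenPos i) = .inl i := by
  rw [Equiv.symm_apply_eq, evenOddEquiv_inl]

@[simp] theorem evenOddEquiv_symm_oddPos (i : Fin (2 ^ n)) :
    (evenOddEquiv n).symm (oddPos i) = .inr i := by
  rw [Equiv.symm_apply_eq, evenOddEquiv_inr]

theorem forall_low_high {p : Fin (2 ^ (n + 1)) → Prop} (h₀ : ∀ i, p (lowPos i))
    (h₁ : ∀ i, p (highPos i)) (k : Fin (2 ^ (n + 1))) : p k := by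
  obtain ⟨i | i, rfl⟩ := (lowHighEquiv n).surjective k
  exacts [h₀ i, h₁ i]

theorem forall_even_odd {p : Fin (2 ^ (n + 1)) → Prop} (h₀ : ∀ i, p (evenPos i))
    (h₁ : ∀ i, p (oddPos i)) (k : Fin (2 ^ (n + 1))) : p k := by
  obtain ⟨i | i, rfl⟩ := (evenOddEquiv n).surjective k
  exacts [h₀ i, h₁ i]

theorem sum_even_odd {M : Type*} [AddCommMonoid M] (f : Fin (2 ^ (n + 1)) → M) :
    ∑ k, f k = ∑ i, f (evenPos i) + ∑ i, f (oddPos i) := by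
  rw [← (evenOddEquiv n).sum_comp f, Fintype.sum_sum_type]
  rfl

theorem sum_low_high {M : Type*} [AddCommMonoid M] (f : Fin (2 ^ (n + 1)) → M) :
    ∑ k, f k = ∑ i, f (lowPos i) + ∑ i, f (highPos i) := by
  rw [← (lowHighEquiv n).sum_comp f, Fintype.sum_sum_type]
  rfl

variable {α : Type*} (a b : Fin (2 ^ n) → α) (i : Fin (2 ^ n))

@[simp] theorem joinHalves_lowPos : joinHalves a b (lowPos i) = a i := by
  simp [joinHalves, lowPos]

@[simp] theorem joinHalves_highPos : joinHalves a b (highPos i) = b i := by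
  simp [joinHalves, highPos]

@[simp] theorem interleave_evenPos : interleave a b (evenPos i) = a i := by
  simp [interleave, evenPos]

@[simp] theorem interleave_oddPos : interleave a b (oddPos i) = b i := by
  have h : (2 * i.val + 1) / 2 = i.val := by omega
  simp [interleave, oddPos, h]

end Positions

/-- The permutation which sends the even positions to the first half and the odd positions to the
second half. -/
def splitPerm (n : ℕ) : Equiv.Perm (Fin (2 ^ (n + 1))) :=
  (evenOddEquiv n).symm.trans (lowHighEquiv n)

@[simp] theorem splitPerm_evenPos {n : ℕ} (i : Fin (2 ^ n)) :
    splitPerm n (evenPos i) = lowPos i := by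
  simp [splitPerm]

@[simp] theorem splitPerm_oddPos {n : ℕ} (i : Fin (2 ^ n)) :
    splitPerm n (oddPos i) = highPos i := by
  simp [splitPerm]

/-! ### Conservation of capacity, and the idle scheme -/

namespace PolarScheme

theorem sum_bitChannel_node {M : Type*} [AddCommMonoid M] (g : BinaryChannel.{u} → M) {n : ℕ}
    (π : Equiv.Perm (Fin (2 ^ (n + 1)))) (skip : Fin (2 ^ n) → Bool) (s₀ s₁ : PolarScheme n)
    (W : Fin (2 ^ (n + 1)) → BinaryChannel.{u}) :
    ∑ k, g ((node π skip s₀ s₁).bitChannel W k) =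
      ∑ i, g (s₀.bitChannel (firstBlock π skip W) i) +
        ∑ i, g (s₁.bitChannel (secondBlock π skip W) i) := by
  rw [sum_low_high]
  simp [bitChannel]

theorem sum_perm_even_odd {M : Type*} [AddCommMonoid M] {n : ℕ} (f : Fin (2 ^ (n + 1)) → M)
    (π : Equiv.Perm (Fin (2 ^ (n + 1)))) :
    ∑ k, f k = ∑ i, f (π (evenPos i)) + ∑ i, f (π (oddPos i)) := by
  rw [← Equiv.sum_comp π f, sum_even_odd]

/-- Polarization preserves the sum of the capacities. -/
theorem sum_symmetricCapacity_bitChannel {n : ℕ} (s : PolarScheme n)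
    (W : Fin (2 ^ n) → BinaryChannel.{u}) :
    ∑ i, (s.bitChannel W i).symmetricCapacity = ∑ i, (W i).symmetricCapacity := by
  induction s with
  | leaf => rfl
  | node π skip s₀ s₁ ih₀ ih₁ =>
    rw [sum_bitChannel_node, ih₀, ih₁, sum_perm_even_odd _ π, ← Finset.sum_add_distrib,
      ← Finset.sum_add_distrib]
    refine Finset.sum_congr rfl fun i _ => ?_
    simp only [firstBlock, secondBlock]
    cases skip i
    · exact BinaryChannel.symmetricCapacity_minus_add_plus _ _
    · rfl

/-- The scheme which skips all operations. -/
def idle : (n : ℕ) → PolarScheme n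
  | 0 => leaf
  | n + 1 => node 1 (fun _ => true) (idle n) (idle n)

theorem sum_bitChannel_idle {M : Type*} [AddCommMonoid M] (g : BinaryChannel.{u} → M) (n : ℕ)
    (W : Fin (2 ^ n) → BinaryChannel.{u}) :
    ∑ i, g ((idle n).bitChannel W i) = ∑ i, g (W i) := by
  induction n with
  | zero => rfl
  | succ n ih =>
    rw [idle, sum_bitChannel_node, ih, ih, sum_perm_even_odd _ 1]
    rfl

end PolarScheme

/-! ### Fast polarization -/

/-- The loss caused by a bit-channel with Bhattacharyya parameter `z`: none if the channel is
reliable up to `τ`, and `1 - z` otherwise. -/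
def polarLoss (τ z : ℝ) : ℝ := if z ≤ τ then 0 else 1 - z

theorem polarLoss_le_one_sub {τ z : ℝ} (hz : z ≤ 1) : polarLoss τ z ≤ 1 - z := by
  unfold polarLoss
  split_ifs <;> linarith

theorem polarLoss_le_one {τ z : ℝ} (hz : 0 ≤ z) : polarLoss τ z ≤ 1 := by
  unfold polarLoss
  split_ifs <;> linarith

theorem sum_le_two_pow {n : ℕ} {f : Fin (2 ^ n) → ℝ} {c : ℝ} (h : ∀ i, f i ≤ c) :
    ∑ i, f i ≤ 2 ^ n * c := by
  have := Finset.sum_le_card_nsmul Finset.univ f c fun i _ => h i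
  simpa using this

namespace PolarScheme

open BinaryChannel

/-- The total loss of a scheme. -/
def loss {n : ℕ} (s : PolarScheme n) (τ : ℝ) (W : Fin (2 ^ n) → BinaryChannel.{u}) : ℝ :=
  ∑ i, polarLoss τ (s.bitChannel W i).bhattacharyya

theorem loss_node {n : ℕ} (π : Equiv.Perm (Fin (2 ^ (n + 1)))) (skip : Fin (2 ^ n) → Bool)
    (s₀ s₁ : PolarScheme n) (τ : ℝ) (W : Fin (2 ^ (n + 1)) → BinaryChannel.{u}) :
    (node π skip s₀ s₁).loss τ W =
      s₀.loss τ (firstBlock π skip W) + s₁.loss τ (secondBlock π skip W) :=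
  sum_bitChannel_node (fun V => polarLoss τ V.bhattacharyya) π skip s₀ s₁ W

theorem loss_le_two_pow {n : ℕ} (s : PolarScheme n) (τ : ℝ) (W : Fin (2 ^ n) → BinaryChannel.{u}) :
    s.loss τ W ≤ 2 ^ n := by
  have := sum_le_two_pow fun i => polarLoss_le_one (τ := τ) (s.bitChannel W i).bhattacharyya_nonneg
  simpa [loss] using this

theorem loss_idle_le {n : ℕ} (τ : ℝ) (W : Fin (2 ^ n) → BinaryChannel.{u}) :
    (idle n).loss τ W ≤ ∑ i, (1 - (W i).bhattacharyya) := by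
  refine (sum_bitChannel_idle (fun V => polarLoss τ V.bhattacharyya) n W).trans_le ?_
  exact Finset.sum_le_sum fun i _ => polarLoss_le_one_sub (W i).bhattacharyya_le_one

/-- Channels which are reasonably reliable from the start polarize fast to reliable channels. -/
theorem exists_loss_le_of_reliable {t : ℝ} (ht : 0 < t) (n : ℕ) :
    ∀ (x : ℝ) (W : Fin (2 ^ n) → BinaryChannel.{u}), 0 ≤ x →
      (∀ i, (W i).bhattacharyya ≤ x ^ 4) →
      ∃ s : PolarScheme n, s.loss (t ^ 4) W ≤ 2 ^ n * (5 * x + 0.7 ^ n * x / t) := by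
  induction n with
  | zero =>
    intro x W hx hW
    refine ⟨leaf, sum_le_two_pow fun i => ?_⟩
    have hz := (W i).bhattacharyya_nonneg
    have hq : 0 ≤ x / t := by positivity
    change polarLoss (t ^ 4) (W i).bhattacharyya ≤ _
    rw [pow_zero (0.7 : ℝ), one_mul]
    unfold polarLoss
    split_ifs with h
    · linarith
    -- A leaf that misses the target has `t < x`, so the summand `x / t` pays for its loss.
    · have : t ^ 4 < x ^ 4 := lt_of_lt_of_le (not_le.1 h) (hW i)
      have h1 : t < x := lt_of_pow_lt_pow_left₀ 4 hx this
      have h2 : 1 ≤ x / t := (one_le_div ht).2 h1.le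
      linarith
  | succ n ih =>
    intro x W hx hW
    have hq : 0 ≤ (0.7 : ℝ) ^ n / t := by positivity
    rcases le_or_gt 0.2 x with h | h
    -- Once `x ≥ 0.2`, the summand `5 * x` pays for the loss of the whole sub-block.
    · refine ⟨idle _, (loss_le_two_pow _ _ _).trans ?_⟩
      have : 1 ≤ 5 * x + 0.7 ^ (n + 1) * x / t := by
        have : 0 ≤ 0.7 ^ (n + 1) * x / t := by positivity
        linarith
      exact le_mul_of_one_le_right (by positivity) this
    -- The constant 1.2 is chosen so that 1.2⁴ = 2.0736 > 2 absorbs the doubling of Z by ⊞; squaring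
    -- `x` accounts for ⊛ exactly.
    · obtain ⟨s₀, h₀⟩ := ih (1.2 * x) (firstBlock 1 (fun _ => false) W) (by positivity) (by
        intro i
        refine (bhattacharyya_minus_le _ _).trans ?_
        have h1 := hW (evenPos i)
        have h2 := hW (oddPos i)
        have h3 := mul_nonneg (W (evenPos i)).bhattacharyya_nonneg
          (W (oddPos i)).bhattacharyya_nonneg
        have h4 : 0 ≤ x ^ 4 := by positivity
        simp only [Equiv.Perm.one_apply, mul_pow]
        norm_num
        linarith)
      obtain ⟨s₁, h₁⟩ := ih (x ^ 2) (secondBlock 1 (fun _ => false) W) (by positivity) (by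
        intro i
        refine (bhattacharyya_plus _ _).trans_le ?_
        refine (mul_le_mul (hW _) (hW _) (bhattacharyya_nonneg _) (by positivity)).trans_eq ?_
        ring)
      refine ⟨node 1 (fun _ => false) s₀ s₁, ?_⟩
      rw [loss_node]
      refine (add_le_add h₀ h₁).trans ?_
      have e1 : (2 : ℝ) ^ n * (5 * (1.2 * x) + 0.7 ^ n * (1.2 * x) / t) +
          2 ^ n * (5 * x ^ 2 + 0.7 ^ n * x ^ 2 / t) =
          2 ^ n * ((5 + 0.7 ^ n / t) * (1.2 * x + x ^ 2)) := by ring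
      have e2 : (2 : ℝ) ^ (n + 1) * (5 * x + 0.7 ^ (n + 1) * x / t) =
          2 ^ n * ((10 + 1.4 * (0.7 ^ n / t)) * x) := by ring
      rw [e1, e2]
      refine mul_le_mul_of_nonneg_left ?_ (by positivity)
      have h5 : 1.2 * x + x ^ 2 ≤ 1.4 * x := by nlinarith
      refine (mul_le_mul_of_nonneg_left h5 (by positivity)).trans ?_
      nlinarith

/-- The loss of a mixed block: the reliable channels are separated from the others by skipping. -/
theorem exists_loss_le_of_sorted {t x : ℝ} (ht : 0 < t) (hx : 0 ≤ x) {m n : ℕ}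
    (hm : 0.7 ^ m ≤ t) (hn : m ≤ n) :
    ∀ W : Fin (2 ^ n) → BinaryChannel.{u}, ∃ s : PolarScheme n, s.loss (t ^ 4) W ≤
      ∑ i, (if (W i).bhattacharyya ≤ x ^ 4 then 6 * x else 1 - (W i).bhattacharyya) + 2 ^ m := by
  induction n, hn using Nat.le_induction with
  | base =>
    -- A block of length 2^m is given up; the summand `2 ^ m` pays for it.
    intro W
    refine ⟨idle m, (loss_le_two_pow _ _ _).trans (le_add_of_nonneg_left ?_)⟩
    refine Finset.sum_nonneg fun i _ => ?_
    have := (W i).bhattacharyya_le_one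
    split_ifs <;> linarith
  | succ n hn ih =>
    intro W
    set f := fun i => (W i).bhattacharyya with hf
    -- With all operations skipped, the even positions form the first sub-block; `splitPerm`
    -- therefore sends the lower half of the sorted block there and the upper half to the second.
    set π : Equiv.Perm (Fin (2 ^ (n + 1))) := (splitPerm n).trans (Tuple.sort f) with hπ
    have mono : Monotone (f ∘ Tuple.sort f) := Tuple.monotone_sort f
    have hlow : ∀ i, π (evenPos i) = Tuple.sort f (lowPos i) := fun i => by simp [hπ]
    have hhigh : ∀ i, π (oddPos i) = Tuple.sort f (highPos i) := fun i => by simp [hπ]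
    rw [sum_perm_even_odd _ π]
    -- Either the lower half is entirely reliable, or the upper half is entirely unreliable. The
    -- pure half is settled at once, and only the other one is bisected further.
    by_cases h : ∀ i, (W (π (evenPos i))).bhattacharyya ≤ x ^ 4
    · obtain ⟨s₀, h₀⟩ := exists_loss_le_of_reliable ht n x (firstBlock π (fun _ => true) W) hx h
      obtain ⟨s₁, h₁⟩ := ih (secondBlock π (fun _ => true) W)
      refine ⟨node π (fun _ => true) s₀ s₁, ?_⟩
      rw [loss_node]
      have e : (2 : ℝ) ^ n * (5 * x + 0.7 ^ n * x / t) ≤ 2 ^ n * (6 * x) := by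
        refine mul_le_mul_of_nonneg_left ?_ (by positivity)
        have h1 : (0.7 : ℝ) ^ n ≤ t :=
          (pow_le_pow_of_le_one (by norm_num) (by norm_num) hn).trans hm
        have : 0.7 ^ n * x / t ≤ x := by
          rw [div_le_iff₀ ht]
          nlinarith
        linarith
      have e2 : ∑ i, (if (W (π (evenPos i))).bhattacharyya ≤ x ^ 4 then 6 * x
          else 1 - (W (π (evenPos i))).bhattacharyya) = 2 ^ n * (6 * x) := by
        rw [Finset.sum_congr rfl fun i _ => if_pos (h i)]
        simp
      rw [e2, add_assoc]
      exact add_le_add (h₀.trans e) h₁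
    · push Not at h
      obtain ⟨j, hj⟩ := h
      have hbad : ∀ i, ¬ (W (π (oddPos i))).bhattacharyya ≤ x ^ 4 := by
        intro i hi
        have := mono (lowPos_lt_highPos j i).le
        rw [hlow] at hj
        rw [hhigh] at hi
        exact absurd (this.trans hi) (not_le.2 hj)
      obtain ⟨s₀, h₀⟩ := ih (firstBlock π (fun _ => true) W)
      refine ⟨node π (fun _ => true) s₀ (idle n), ?_⟩
      rw [loss_node, Finset.sum_congr rfl fun i _ => if_neg (hbad i), add_right_comm]
      exact add_le_add h₀ (loss_idle_le _ _)

end PolarScheme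

/-! ### Slow polarization: a potential for neighbouring pairs of a sorted block -/

/-- The summands are lengths of non-overlapping subintervals of [0, 1]. -/
theorem sum_odd_sub_even_le_one {n : ℕ} {f : Fin (2 ^ (n + 1)) → ℝ} (hf : Monotone f)
    (h0 : ∀ i, 0 ≤ f i) (h1 : ∀ i, f i ≤ 1) :
    ∑ i, (f (oddPos i) - f (evenPos i)) ≤ 1 := by
  -- The value 1 past the end keeps `g` monotone and closes the telescoping sum at index 2^(n+1).
  set g : ℕ → ℝ := fun k => if h : k < 2 ^ (n + 1) then f ⟨k, h⟩ else 1 with hg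
  have mono : Monotone g := by
    intro a b hab
    simp only [hg]
    split_ifs with ha hb
    · exact hf hab
    · exact h1 _
    · omega
    · exact le_rfl
  have key : ∀ m : ℕ, ∑ i ∈ Finset.range m, (g (2 * i + 1) - g (2 * i)) ≤ g (2 * m) - g 0 := by
    intro m
    induction m with
    | zero => simp
    | succ m ih =>
      rw [Finset.sum_range_succ]
      have := mono (show 2 * m + 1 ≤ 2 * (m + 1) by omega)
      linarith
  have h := key (2 ^ n)
  rw [Finset.sum_range] at h
  have e : ∀ i : Fin (2 ^ n), g (2 * i + 1) - g (2 * i) = f (oddPos i) - f (evenPos i) := by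
    intro i
    have h1 : 2 * i.val + 1 < 2 ^ (n + 1) := (oddPos i).isLt
    have h2 : 2 * i.val < 2 ^ (n + 1) := (evenPos i).isLt
    simp only [hg, dif_pos h1, dif_pos h2]
    rfl
  rw [Finset.sum_congr rfl fun i _ => e i] at h
  have hb : g (2 * 2 ^ n) = 1 := by simp [hg, pow_succ, mul_comm]
  have ha : 0 ≤ g 0 := by simp only [hg]; split_ifs <;> [exact h0 _; norm_num]
  linarith

/-- The decrease of the potential `2 z - z ^ 2` when a pair is polarized. -/
theorem potential_decrease {a b m p : ℝ} (ha : 0 ≤ a) (hab : a ≤ b) (hb : b ≤ 1)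
    (hm : m ≤ a + b - a * b) (hp : p = a * b) :
    (2 * m - m ^ 2) + (2 * p - p ^ 2) ≤ (2 * a - a ^ 2) + (2 * b - b ^ 2) -
      ((a * (1 - a)) ^ 2 + (b * (1 - b)) ^ 2) + (b - a) := by
  subst hp
  -- The potential is increasing up to 1, so `m` may be replaced by its upper bound. The decrease is
  -- then exactly 2 h(a) h(b) with h(z) = z (1 - z), that is h(a)² + h(b)² - (h(a) - h(b))².
  have h1 : 2 * m - m ^ 2 ≤ 2 * (a + b - a * b) - (a + b - a * b) ^ 2 := by
    have : a + b - a * b ≤ 1 := by nlinarith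
    nlinarith
  -- The function h is 1-Lipschitz on [0, 1], and (b - a)² ≤ b - a there.
  have h2 : (a * (1 - a) - b * (1 - b)) ^ 2 ≤ b - a := by
    have e : (a * (1 - a) - b * (1 - b)) ^ 2 = (b - a) * ((b - a) * (1 - a - b) ^ 2) := by ring
    rw [e]
    have h3 : (1 - a - b) ^ 2 ≤ 1 := by nlinarith
    have h4 : (b - a) * (1 - a - b) ^ 2 ≤ 1 := by nlinarith
    nlinarith
  nlinarith

namespace PolarScheme

open BinaryChannel

/-- The loss after up to `r` polarization steps with sorted pairs. -/
theorem exists_loss_le {t x : ℝ} (ht : 0 < t) (hx : 0 < x) {m : ℕ} (hm : 0.7 ^ m ≤ t) (r : ℕ) :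
    ∀ (n : ℕ), m + r ≤ n → ∀ W : Fin (2 ^ n) → BinaryChannel.{u}, ∃ s : PolarScheme n,
      s.loss (t ^ 4) W + 1 / x ^ 10 ≤ 6 * x * 2 ^ n + 1 / x ^ 10 / (r + 1) *
        ∑ i, (2 * (W i).bhattacharyya - (W i).bhattacharyya ^ 2) +
        2 ^ (r + 1) * (1 / x ^ 10 + 2 ^ m) := by
  have hB : 0 < 1 / x ^ 10 := by positivity
  set B := 1 / x ^ 10 with hBdef
  -- Stopping at once: a channel is reliable (Z ≤ x⁴), nearly useless (1 - Z ≤ x), or has Z (1 - Z)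
  -- ≥ x⁵, and then its loss of at most 1 is below B (Z (1 - Z))² because B = x^(-10).
  have early : ∀ (r n : ℕ), m ≤ n → ∀ W : Fin (2 ^ n) → BinaryChannel.{u}, ∃ s : PolarScheme n,
      s.loss (t ^ 4) W + B ≤ 6 * x * 2 ^ n + B *
        ∑ i, ((W i).bhattacharyya * (1 - (W i).bhattacharyya)) ^ 2 +
        2 ^ (r + 1) * (B + 2 ^ m) := by
    intro r n hn W
    obtain ⟨s, hs⟩ := exists_loss_le_of_sorted ht hx.le hm hn W
    refine ⟨s, ?_⟩
    have h1 : ∑ i, (if (W i).bhattacharyya ≤ x ^ 4 then 6 * x else 1 - (W i).bhattacharyya) ≤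
        ∑ i, (6 * x + B * ((W i).bhattacharyya * (1 - (W i).bhattacharyya)) ^ 2) := by
      refine Finset.sum_le_sum fun i _ => ?_
      set z := (W i).bhattacharyya
      have hz1 : z ≤ 1 := (W i).bhattacharyya_le_one
      have hz0 : 0 ≤ z := (W i).bhattacharyya_nonneg
      split_ifs with h
      · have : 0 ≤ B * (z * (1 - z)) ^ 2 := by positivity
        linarith
      · rcases le_or_gt (1 - z) x with h2 | h2
        · have : 0 ≤ B * (z * (1 - z)) ^ 2 := by positivity
          linarith
        · have h3 : x ^ 4 * x ≤ z * (1 - z) :=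
            mul_le_mul (not_le.1 h).le h2.le hx.le hz0
          have h4 : (x ^ 4 * x) ^ 2 ≤ (z * (1 - z)) ^ 2 :=
            pow_le_pow_left₀ (by positivity) h3 2
          have h5 : 1 ≤ B * (z * (1 - z)) ^ 2 := by
            refine le_trans (le_of_eq ?_) (mul_le_mul_of_nonneg_left h4 hB.le)
            rw [hBdef]
            field_simp
          linarith
    have h2 : ∑ _i : Fin (2 ^ n), 6 * x = 6 * x * 2 ^ n := by simp [mul_comm]
    rw [Finset.sum_add_distrib, h2, ← Finset.mul_sum] at h1
    have h3 : 2 * (B + 2 ^ m) ≤ 2 ^ (r + 1) * (B + 2 ^ m) := by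
      refine mul_le_mul_of_nonneg_right ?_ (by positivity)
      have : (1 : ℝ) ≤ 2 ^ r := one_le_pow₀ one_le_two
      rw [pow_succ]
      linarith
    have h4 : (0 : ℝ) < 2 ^ m := by positivity
    linarith
  induction r with
  | zero =>
    intro n hn W
    obtain ⟨s, hs⟩ := early 0 n (by omega) W
    refine ⟨s, hs.trans ?_⟩
    have : ∑ i, ((W i).bhattacharyya * (1 - (W i).bhattacharyya)) ^ 2 ≤
        ∑ i, (2 * (W i).bhattacharyya - (W i).bhattacharyya ^ 2) := by
      refine Finset.sum_le_sum fun i _ => ?_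
      have hz1 := (W i).bhattacharyya_le_one
      have hz0 := (W i).bhattacharyya_nonneg
      have h1 : (W i).bhattacharyya * (1 - (W i).bhattacharyya) ≤ (W i).bhattacharyya := by
        nlinarith
      have h2 : 0 ≤ (W i).bhattacharyya * (1 - (W i).bhattacharyya) :=
        mul_nonneg hz0 (by linarith)
      nlinarith
    have := mul_le_mul_of_nonneg_left this hB.le
    simpa using this
  | succ r ih =>
    intro n hn W
    obtain ⟨n, rfl⟩ : ∃ k, n = k + 1 := ⟨n - 1, by omega⟩
    set F := ∑ i, (2 * (W i).bhattacharyya - (W i).bhattacharyya ^ 2) with hF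
    set V := ∑ i, ((W i).bhattacharyya * (1 - (W i).bhattacharyya)) ^ 2 with hV
    have hr : (0 : ℝ) < r + 1 := by positivity
    push_cast
    -- If the guaranteed decrease `V` is small, stop: few channels are intermediate. Otherwise one
    -- step multiplies `F` by at most (r + 1) / (r + 2), up to an additive 1, which is how the
    -- coefficient `B / (r + 1)` becomes `B / (r + 2)`.
    rcases le_or_gt V (F / (r + 1 + 1)) with h | h
    · obtain ⟨s, hs⟩ := early (r + 1) (n + 1) (by omega) W
      refine ⟨s, hs.trans ?_⟩
      have := mul_le_mul_of_nonneg_left h hB.le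
      have e : B / (r + 1 + 1) * F = B * (F / (r + 1 + 1)) := by ring
      rw [e]
      linarith
    · set f := fun i => (W i).bhattacharyya with hf
      set π := Tuple.sort f with hπ
      have mono : Monotone (f ∘ π) := Tuple.monotone_sort f
      obtain ⟨s₀, h₀⟩ := ih n (by omega) (firstBlock π (fun _ => false) W)
      obtain ⟨s₁, h₁⟩ := ih n (by omega) (secondBlock π (fun _ => false) W)
      refine ⟨node π (fun _ => false) s₀ s₁, ?_⟩
      rw [loss_node]
      set F₀ := ∑ i, (2 * (firstBlock π (fun _ => false) W i).bhattacharyya -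
        (firstBlock π (fun _ => false) W i).bhattacharyya ^ 2) with hF₀
      set F₁ := ∑ i, (2 * (secondBlock π (fun _ => false) W i).bhattacharyya -
        (secondBlock π (fun _ => false) W i).bhattacharyya ^ 2) with hF₁
      have hdec : F₀ + F₁ ≤ F - V + 1 := by
        have hone := sum_odd_sub_even_le_one mono (fun i => (W _).bhattacharyya_nonneg)
          (fun i => (W _).bhattacharyya_le_one)
        have hle : F₀ + F₁ ≤ F - V + ∑ i, ((f ∘ π) (oddPos i) - (f ∘ π) (evenPos i)) := by
          rw [hF, hV, sum_perm_even_odd _ π, sum_perm_even_odd (fun i => (_ : ℝ) ^ 2) π, hF₀, hF₁,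
            ← Finset.sum_add_distrib, ← Finset.sum_add_distrib, ← Finset.sum_add_distrib,
            ← Finset.sum_sub_distrib, ← Finset.sum_add_distrib]
          refine Finset.sum_le_sum fun i _ => ?_
          refine potential_decrease (bhattacharyya_nonneg _) (mono ?_) (bhattacharyya_le_one _)
            (bhattacharyya_minus_le _ _) (bhattacharyya_plus _ _)
          simp [evenPos, oddPos]
        linarith
      have hF1 : F - V + 1 ≤ F * ((r + 1) / (r + 1 + 1)) + 1 := by
        have : F - F / (r + 1 + 1) = F * ((r + 1) / (r + 1 + 1)) := by field_simp; ring
        linarith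
      -- The extra `B` comes from the additive 1. It is absorbed by the left side of the induction
      -- hypotheses, which carry `B` twice while the goal carries it once.
      have h5 : B / (r + 1) * (F₀ + F₁) ≤ B / (r + 1 + 1) * F + B := by
        refine (mul_le_mul_of_nonneg_left (hdec.trans hF1) (by positivity)).trans ?_
        have e : B / (r + 1) * (F * ((r + 1) / (r + 1 + 1)) + 1) =
            B / (r + 1 + 1) * F + B / (r + 1) := by field_simp
        rw [e]
        have : B / ((r : ℝ) + 1) ≤ B := div_le_self hB.le (by simp)
        linarith
      have e6 : (2 : ℝ) ^ (r + 1 + 1) * (B + 2 ^ m) = 2 * (2 ^ (r + 1) * (B + 2 ^ m)) := by ring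
      have e7 : 6 * x * (2 : ℝ) ^ (n + 1) = 2 * (6 * x * 2 ^ n) := by ring
      rw [e6, e7]
      rw [mul_add] at h5
      linarith

/-- Every long block of channels has a scheme with small total loss. -/
theorem exists_loss_le_mul {ε : ℝ} (hε : 0 < ε) :
    ∃ n₀ : ℕ, ∀ n, n₀ ≤ n → ∀ W : Fin (2 ^ n) → BinaryChannel.{u},
      ∃ (s : PolarScheme n) (τ : ℝ), 0 ≤ τ ∧ 2 ^ n * τ ≤ ε ∧ s.loss τ W ≤ ε * 2 ^ n := by
  -- Each of the four error terms of `exists_loss_le` is to be at most ε / 4 of the block length: 6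
  -- x = ε / 4, `r` makes B / (r + 1) small, `k` makes 2^m negligible against 2^(m + k), and `n₁`
  -- takes care of the constant.
  set x := ε / 24 with hx
  have hx0 : 0 < x := by positivity
  set B := 1 / x ^ 10 with hB
  have hB0 : 0 < B := by positivity
  obtain ⟨r, hr⟩ := exists_nat_gt (4 * B / ε)
  obtain ⟨k₀, hk₀⟩ := pow_unbounded_of_one_lt (4 * 2 ^ (r + 1) / ε) (one_lt_two (α := ℝ))
  set k := k₀ + r with hk
  obtain ⟨n₁, hn₁⟩ := pow_unbounded_of_one_lt (4 * (2 ^ (r + 1) * B) / ε + 4 ^ k / ε)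
    (one_lt_two (α := ℝ))
  refine ⟨n₁ + k, fun n hn W => ?_⟩
  have hn2 : 4 * (2 ^ (r + 1) * B) / ε + 4 ^ k / ε ≤ 2 ^ n :=
    hn₁.le.trans (pow_le_pow_right₀ one_le_two (by omega))
  obtain ⟨m, rfl⟩ : ∃ m, n = m + k := ⟨n - k, by omega⟩
  have ht : (0 : ℝ) < 0.7 ^ m := by positivity
  obtain ⟨s, hs⟩ := exists_loss_le ht hx0 le_rfl r (m + k) (by omega) W
  have hq1 : 0 ≤ 4 * (2 ^ (r + 1) * B) / ε := by positivity
  have hq2 : 0 ≤ 4 ^ k / ε := by positivity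
  refine ⟨s, (0.7 ^ m) ^ 4, by positivity, ?_, ?_⟩
  · have h1 : 4 ^ k / ε ≤ 2 ^ (m + k) := by linarith
    rw [div_le_iff₀ hε] at h1
    have h2 : (2 : ℝ) ^ (m + k) * (0.7 ^ m) ^ 4 = 2 ^ k * (2 * 0.7 ^ 4) ^ m := by
      rw [mul_pow, ← pow_mul, ← pow_mul, mul_comm m 4, pow_add]; ring
    -- Here 2 · 0.7⁴ = 0.4802 < 1 / 2: the block length grows more slowly than the reliability
    -- threshold shrinks.
    have h3 : (2 * 0.7 ^ 4 : ℝ) ^ m ≤ (1 / 2) ^ m :=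
      pow_le_pow_left₀ (by positivity) (by norm_num) m
    have h4 : (4 : ℝ) ^ k = 2 ^ k * 2 ^ k := by rw [← mul_pow]; norm_num
    rw [h2]
    refine (mul_le_mul_of_nonneg_left h3 (by positivity)).trans ?_
    rw [h4, pow_add 2 m k] at h1
    have h5 : (2 : ℝ) ^ k ≤ 2 ^ m * ε := by
      have : (0 : ℝ) < 2 ^ k := by positivity
      nlinarith
    rw [div_pow, one_pow, mul_one_div, div_le_iff₀ (by positivity)]
    linarith
  · have hF : ∑ i, (2 * (W i).bhattacharyya - (W i).bhattacharyya ^ 2) ≤ 2 ^ (m + k) := by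
      have := sum_le_two_pow (n := m + k) (c := 1)
        (f := fun i => 2 * (W i).bhattacharyya - (W i).bhattacharyya ^ 2)
        (fun i => by nlinarith [sq_nonneg (1 - (W i).bhattacharyya)])
      simpa using this
    set N : ℝ := 2 ^ (m + k) with hN
    have hN0 : 0 < N := by positivity
    have h1 : B / (r + 1) ≤ ε / 4 := by
      rw [div_lt_iff₀ hε] at hr
      rw [div_le_iff₀ (by positivity)]
      nlinarith
    have h2 : B / (r + 1) * ∑ i, (2 * (W i).bhattacharyya - (W i).bhattacharyya ^ 2) ≤
        ε / 4 * N := by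
      refine (mul_le_mul_of_nonneg_left hF (by positivity)).trans ?_
      exact mul_le_mul_of_nonneg_right h1 hN0.le
    have h3 : 2 ^ (r + 1) * B ≤ ε / 4 * N := by
      have : 4 * (2 ^ (r + 1) * B) / ε ≤ N := by linarith
      rw [div_le_iff₀ hε] at this
      linarith
    have h4 : (2 : ℝ) ^ (r + 1) * 2 ^ m ≤ ε / 4 * N := by
      have h5 : 4 * 2 ^ (r + 1) / ε ≤ 2 ^ k :=
        hk₀.le.trans (pow_le_pow_right₀ one_le_two (by omega))
      rw [div_le_iff₀ hε] at h5
      have h6 : (0 : ℝ) < 2 ^ m := by positivity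
      rw [hN, pow_add 2 m k, pow_succ]
      rw [pow_succ] at h5
      nlinarith
    have h7 : 6 * x * N = ε / 4 * N := by rw [hx]; ring
    rw [h7, mul_add] at hs
    linarith

/-- The number of reliable bit-channels is nearly the total capacity. -/
theorem sum_symmetricCapacity_le {n : ℕ} (s : PolarScheme n) (τ : ℝ)
    (W : Fin (2 ^ n) → BinaryChannel.{u}) :
    ∑ i, (W i).symmetricCapacity ≤
      (Finset.univ.filter fun i => (s.bitChannel W i).bhattacharyya ≤ τ).card +
        2 / Real.log 2 * s.loss τ W := by
  rw [← s.sum_symmetricCapacity_bitChannel W, loss, Finset.mul_sum, Finset.card_filter]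
  push_cast
  rw [← Finset.sum_add_distrib]
  refine Finset.sum_le_sum fun i _ => ?_
  unfold polarLoss
  split_ifs
  · simpa using symmetricCapacity_le_one _
  · simpa using symmetricCapacity_le_one_sub_bhattacharyya _

end PolarScheme

/-! ### Products of sums over independent coordinates -/

theorem ENNReal.prod_tsum_eq_tsum_prod {m : ℕ} {α : Fin m → Type*} (f : (i : Fin m) → α i → ℝ≥0∞) :
    ∏ i, ∑' a, f i a = ∑' y : (i : Fin m) → α i, ∏ i, f i (y i) := by
  induction m with
  | zero => simp
  | succ m ih =>
    rw [Fin.prod_univ_succ, ih, ← (Fin.consEquiv α).tsum_eq, ENNReal.tsum_prod',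
      ← ENNReal.tsum_mul_right]
    refine tsum_congr fun a => ?_
    rw [← ENNReal.tsum_mul_left]
    refine tsum_congr fun y => ?_
    rw [Fin.prod_univ_succ]
    rfl

open Classical in
-- Change of variables: the image of a product weight under a coordinatewise map is the product of
-- the image weights.
theorem ENNReal.tsum_prod_mul_comp {m : ℕ} {α β : Fin m → Type*} (h : (i : Fin m) → α i → β i)
    (p : (i : Fin m) → α i → ℝ≥0∞) (G : ((i : Fin m) → β i) → ℝ≥0∞) :
    ∑' y : (i : Fin m) → α i, (∏ i, p i (y i)) * G (fun i => h i (y i)) =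
      ∑' z : (i : Fin m) → β i, (∏ i, ∑' a, if h i a = z i then p i a else 0) * G z := by
  have e : ∀ z : (i : Fin m) → β i, (∏ i, ∑' a, if h i a = z i then p i a else 0) * G z =
      ∑' y : (i : Fin m) → α i,
        if z = (fun i => h i (y i)) then (∏ i, p i (y i)) * G (fun i => h i (y i)) else 0 := by
    intro z
    rw [ENNReal.prod_tsum_eq_tsum_prod, ← ENNReal.tsum_mul_right]
    refine tsum_congr fun y => ?_
    split_ifs with hz
    · subst hz
      simp
    · obtain ⟨i, hi⟩ : ∃ i, h i (y i) ≠ z i := by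
        by_contra! hc
        exact hz (funext fun i => (hc i).symm)
      rw [Finset.prod_eq_zero (Finset.mem_univ i) (if_neg hi), zero_mul]
  rw [tsum_congr e, ENNReal.tsum_comm]
  refine tsum_congr fun y => ?_
  rw [tsum_ite_eq]

/-- The entries of a permuted block, grouped into consecutive pairs. -/
def pairEquiv {n : ℕ} (α : Fin (2 ^ (n + 1)) → Type*) (π : Equiv.Perm (Fin (2 ^ (n + 1)))) :
    ((k : Fin (2 ^ (n + 1))) → α k) ≃
      ((i : Fin (2 ^ n)) → α (π (evenPos i)) × α (π (oddPos i))) :=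
  Equiv.ofBijective (fun y i => (y (π (evenPos i)), y (π (oddPos i)))) <| by
    constructor
    · intro y z hyz
      funext k
      obtain ⟨k, rfl⟩ := π.surjective k
      refine forall_even_odd (p := fun k => y (π k) = z (π k)) (fun i => ?_) (fun i => ?_) k
      · exact congrArg Prod.fst (congrFun hyz i)
      · exact congrArg Prod.snd (congrFun hyz i)
    · intro z
      refine ⟨Equiv.piCongrLeft α ((evenOddEquiv n).trans π) fun s => match s with
        | .inl i => (z i).1
        | .inr i => (z i).2, ?_⟩
      funext i
      refine Prod.ext ?_ ?_
      · exact Equiv.piCongrLeft_apply_apply α ((evenOddEquiv n).trans π) _ (.inl i)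
      · exact Equiv.piCongrLeft_apply_apply α ((evenOddEquiv n).trans π) _ (.inr i)

theorem prod_perm_even_odd {M : Type*} [CommMonoid M] {n : ℕ} (f : Fin (2 ^ (n + 1)) → M)
    (π : Equiv.Perm (Fin (2 ^ (n + 1)))) :
    ∏ k, f k = ∏ i, f (π (evenPos i)) * f (π (oddPos i)) := by
  rw [← Equiv.prod_comp π f, ← (evenOddEquiv n).prod_comp, Fintype.prod_sum_type,
    Finset.prod_mul_distrib]
  rfl

theorem sum_halves {M : Type*} [AddCommMonoid M] {n : ℕ}
    (g : (Fin (2 ^ n) → ZMod 2) → (Fin (2 ^ n) → ZMod 2) → M) :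
    ∑ u : Fin (2 ^ (n + 1)) → ZMod 2, g (fun i => u (lowPos i)) (fun i => u (highPos i)) =
      ∑ a, ∑ b, g a b := by
  rw [← Fintype.sum_prod_type']
  exact (((lowHighEquiv n).arrowCongr (Equiv.refl (ZMod 2))).symm.trans
    (Equiv.sumArrowEquivProdArrow _ _ _)).sum_comp fun p => g p.1 p.2

namespace BinaryChannel

open Classical in
-- The factor 2 undoes the uniform weight of the bit `x`. When the operation is skipped, the output
-- of `W₂` sums to 1 for both values of `x`.
theorem sum_tsum_firstOut (skip : Bool) (W₁ W₂ : BinaryChannel.{u}) (v : ZMod 2)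
    (z : (first skip W₁ W₂).Out) :
    (∑ x : ZMod 2, ∑' p : W₁.Out × W₂.Out, if firstOut skip p.1 p.2 = z then
      W₁.law (if skip then v else v + x) p.1 * W₂.law x p.2 else 0) =
      2 * (first skip W₁ W₂).law v z := by
  cases skip
  · obtain ⟨z₁, z₂⟩ := z
    refine Eq.trans ?_ (congrArg (2 * ·) (minus_law W₁ W₂ v z₁ z₂)).symm
    rw [← mul_assoc, ENNReal.mul_inv_cancel two_ne_zero ENNReal.ofNat_ne_top, one_mul]
    refine Finset.sum_congr rfl fun x _ => ?_
    rw [tsum_eq_single (z₁, z₂)]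
    · exact if_pos rfl
    · intro p hp
      exact if_neg hp
  · change W₁.Out at z
    rw [sum_zmod_two, two_mul]
    congr 1 <;>
    · rw [ENNReal.tsum_prod', tsum_eq_single z]
      · refine Eq.trans (tsum_congr fun b => if_pos rfl) ?_
        exact (ENNReal.tsum_mul_left.trans (congrArg (W₁.law v z * ·) (PMF.tsum_coe _))).trans
          (mul_one _)
      · intro a ha
        exact ENNReal.tsum_eq_zero.2 fun b => if_neg ha

open Classical in
theorem sum_tsum_secondOut (skip : Bool) (W₁ W₂ : BinaryChannel.{u}) (v : ZMod 2)
    (z : (second skip W₁ W₂).Out) :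
    (∑ x : ZMod 2, ∑' p : W₁.Out × W₂.Out, if secondOut skip p.1 p.2 x = z then
      W₁.law (if skip then x else x + v) p.1 * W₂.law v p.2 else 0) =
      2 * (second skip W₁ W₂).law v z := by
  cases skip
  · obtain ⟨z₁, z₂, w⟩ := z
    refine Eq.trans ?_ (congrArg (2 * ·) (plus_law W₁ W₂ w v z₁ z₂)).symm
    rw [← mul_assoc, ENNReal.mul_inv_cancel two_ne_zero ENNReal.ofNat_ne_top, one_mul,
      Finset.sum_eq_single w]
    · rw [tsum_eq_single (z₁, z₂)]
      · exact if_pos rfl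
      · intro p hp
        refine if_neg fun h => hp ?_
        have h' : (p.1, p.2, w) = (z₁, z₂, w) := h
        simp only [Prod.mk.injEq] at h'
        exact Prod.ext h'.1 h'.2.1
    · intro x _ hx
      refine ENNReal.tsum_eq_zero.2 fun p => if_neg fun h => hx ?_
      have h' : (p.1, p.2, x) = (z₁, z₂, w) := h
      simp only [Prod.mk.injEq] at h'
      exact h'.2.2
    · simp
  · change W₂.Out at z
    rw [sum_zmod_two, two_mul]
    congr 1 <;>
    · rw [ENNReal.tsum_prod', ENNReal.tsum_comm, tsum_eq_single z]
      · refine Eq.trans (tsum_congr fun b => if_pos rfl) ?_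
        exact (ENNReal.tsum_mul_right.trans (congrArg (· * W₂.law v z) (PMF.tsum_coe _))).trans
          (one_mul _)
      · intro a ha
        exact ENNReal.tsum_eq_zero.2 fun b => if_neg ha

/-! ### Symmetries -/

/-- The map `τ` of the output alphabet translates the channel by the bit `g`. -/
def Shifts (W : BinaryChannel.{u}) (g : ZMod 2) (τ : W.Out → W.Out) : Prop :=
  ∀ x y, W.law (x + g) (τ y) = W.law x y

/-- The map of the outputs of `first skip W₁ W₂` induced by maps of the outputs of `W₁`, `W₂`. -/
def firstMap (skip : Bool) {W₁ W₂ : BinaryChannel.{u}} (τ₁ : W₁.Out → W₁.Out)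
    (τ₂ : W₂.Out → W₂.Out) : (first skip W₁ W₂).Out → (first skip W₁ W₂).Out :=
  match skip with
  | true => τ₁
  | false => fun y : W₁.Out × W₂.Out => (τ₁ y.1, τ₂ y.2)

/-- The map of the outputs of `second skip W₁ W₂` induced by maps of the outputs of `W₁`, `W₂` and
a translation of the input of the first channel. -/
def secondMap (skip : Bool) {W₁ W₂ : BinaryChannel.{u}} (τ₁ : W₁.Out → W₁.Out)
    (τ₂ : W₂.Out → W₂.Out) (v : ZMod 2) : (second skip W₁ W₂).Out → (second skip W₁ W₂).Out :=
  match skip with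
  | true => τ₂
  | false => fun y : W₁.Out × W₂.Out × ZMod 2 => (τ₁ y.1, τ₂ y.2.1, y.2.2 + v)

/-- The translation by `v₁` is absorbed by reindexing the uniform bit. The shifts required of `W₁`
and `W₂` are those that the encoder produces from `v₀`, `v₁`. -/
theorem Shifts.first {skip : Bool} {W₁ W₂ : BinaryChannel.{u}} {τ₁ : W₁.Out → W₁.Out}
    {τ₂ : W₂.Out → W₂.Out} {v₀ v₁ : ZMod 2} (h₁ : W₁.Shifts (if skip then v₀ else v₀ + v₁) τ₁)
    (h₂ : W₂.Shifts v₁ τ₂) :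
    (BinaryChannel.first skip W₁ W₂).Shifts v₀ (firstMap skip τ₁ τ₂) := by
  cases skip
  · rintro x ⟨y₁, y₂⟩
    refine (minus_law W₁ W₂ (x + v₀) (τ₁ y₁) (τ₂ y₂)).trans ?_
    refine Eq.trans ?_ (minus_law W₁ W₂ x y₁ y₂).symm
    congr 1
    rw [← Equiv.sum_comp (Equiv.addRight v₁)]
    refine Finset.sum_congr rfl fun w _ => ?_
    rw [Equiv.coe_addRight, h₂ w y₂, ← h₁ (x + w) y₁]
    congr 3
    simp only [Bool.false_eq_true, if_false]
    ring
  · exact h₁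

theorem Shifts.second {skip : Bool} {W₁ W₂ : BinaryChannel.{u}} {τ₁ : W₁.Out → W₁.Out}
    {τ₂ : W₂.Out → W₂.Out} {v₀ v₁ : ZMod 2} (h₁ : W₁.Shifts (if skip then v₀ else v₀ + v₁) τ₁)
    (h₂ : W₂.Shifts v₁ τ₂) :
    (BinaryChannel.second skip W₁ W₂).Shifts v₁ (secondMap skip τ₁ τ₂ v₀) := by
  cases skip
  · rintro x ⟨y₁, y₂, w⟩
    refine (plus_law W₁ W₂ (w + v₀) (x + v₁) (τ₁ y₁) (τ₂ y₂)).trans ?_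
    refine Eq.trans ?_ (plus_law W₁ W₂ w x y₁ y₂).symm
    rw [h₂ x y₂, ← h₁ (w + x) y₁]
    congr 4
    simp only [Bool.false_eq_true, if_false]
    ring
  · exact h₂

theorem IsSymmetric.exists_shifts {W : BinaryChannel.{u}} (hW : W.IsSymmetric) (g : ZMod 2) :
    ∃ τ : W.Out ≃ W.Out, W.Shifts g τ := by
  obtain ⟨σ, hσ, h⟩ := hW
  rcases zmod_two_eq_zero_or_one g with rfl | rfl
  · exact ⟨Equiv.refl _, fun x y => by simp⟩
  · refine ⟨hσ.toPerm, fun x y => ?_⟩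
    rcases zmod_two_eq_zero_or_one x with rfl | rfl
    · rw [zero_add, h]
      exact congrArg _ (hσ y)
    · rw [zmod_two_add_self, h]
      rfl

/-- The error probability of a single use of a channel is at most its Bhattacharyya parameter. -/
theorem tsum_error_le_bhattacharyya (W : BinaryChannel.{u}) (x : ZMod 2) :
    (∑' y, W.law x y * (if W.law (x + 1) y < W.law x y then 0 else 1)) ≤
      ENNReal.ofReal W.bhattacharyya := by
  rw [bhattacharyya, ENNReal.ofReal_tsum_of_nonneg (fun _ => Real.sqrt_nonneg _)
    W.hasSum_bhattacharyya.summable]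
  refine ENNReal.tsum_le_tsum fun y => ?_
  split_ifs with h
  · simp
  · rw [mul_one]
    have h' : W.prob y x ≤ W.prob y (x + 1) :=
      ENNReal.toReal_mono ((W.law _).apply_ne_top y) (not_lt.1 h)
    have e : W.law x y = ENNReal.ofReal (W.prob y x) :=
      (ENNReal.ofReal_toReal ((W.law x).apply_ne_top y)).symm
    rw [e]
    refine ENNReal.ofReal_le_ofReal (Real.le_sqrt_of_sq_le ?_)
    have hn := W.prob_nonneg y x
    rcases zmod_two_eq_zero_or_one x with rfl | rfl
    · rw [zero_add] at h'
      nlinarith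
    · rw [zmod_two_add_self] at h'
      nlinarith

end BinaryChannel

namespace PolarScheme

open BinaryChannel

/-! ### The encoder -/

theorem encode_node_even {n : ℕ} (π : Equiv.Perm (Fin (2 ^ (n + 1)))) (skip : Fin (2 ^ n) → Bool)
    (s₀ s₁ : PolarScheme n) (u : Fin (2 ^ (n + 1)) → ZMod 2) (i : Fin (2 ^ n)) :
    (node π skip s₀ s₁).encode u (π (evenPos i)) =
      if skip i then s₀.encode (fun i => u (lowPos i)) i
      else s₀.encode (fun i => u (lowPos i)) i + s₁.encode (fun i => u (highPos i)) i := by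
  simp [encode]

theorem encode_node_odd {n : ℕ} (π : Equiv.Perm (Fin (2 ^ (n + 1)))) (skip : Fin (2 ^ n) → Bool)
    (s₀ s₁ : PolarScheme n) (u : Fin (2 ^ (n + 1)) → ZMod 2) (i : Fin (2 ^ n)) :
    (node π skip s₀ s₁).encode u (π (oddPos i)) = s₁.encode (fun i => u (highPos i)) i := by
  simp [encode]

theorem encode_add {n : ℕ} (s : PolarScheme n) (u w : Fin (2 ^ n) → ZMod 2) :
    s.encode (fun i => u i + w i) = fun i => s.encode u i + s.encode w i := by
  induction s with
  | leaf => rfl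
  | node π skip s₀ s₁ ih₀ ih₁ =>
    funext k
    obtain ⟨k, rfl⟩ := π.surjective k
    revert k
    refine forall_even_odd (fun i => ?_) (fun i => ?_)
    · rw [encode_node_even, encode_node_even, encode_node_even,
        ih₀ (fun i => u (lowPos i)) (fun i => w (lowPos i)),
        ih₁ (fun i => u (highPos i)) (fun i => w (highPos i))]
      split_ifs
      · rfl
      · ring
    · rw [encode_node_odd, encode_node_odd, encode_node_odd,
        ih₁ (fun i => u (highPos i)) (fun i => w (highPos i))]

theorem encode_injective {n : ℕ} (s : PolarScheme n) : Function.Injective s.encode := by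
  induction s with
  | leaf => exact fun _ _ h => h
  | node π skip s₀ s₁ ih₀ ih₁ =>
    intro u w h
    have h₁ : s₁.encode (fun i => u (highPos i)) = s₁.encode (fun i => w (highPos i)) := by
      funext i
      rw [← encode_node_odd π skip s₀, h, encode_node_odd]
    have h₀ : s₀.encode (fun i => u (lowPos i)) = s₀.encode (fun i => w (lowPos i)) := by
      funext i
      have := congrFun h (π (evenPos i))
      rw [encode_node_even, encode_node_even, h₁] at this
      split_ifs at this
      · exact this
      · exact add_right_cancel this
    exact funext (forall_low_high (congrFun (ih₀ h₀)) (congrFun (ih₁ h₁)))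

theorem sum_encode {M : Type*} [AddCommMonoid M] {n : ℕ} (s : PolarScheme n)
    (g : (Fin (2 ^ n) → ZMod 2) → M) : ∑ u, g (s.encode u) = ∑ v, g v :=
  (Equiv.ofBijective _ (Finite.injective_iff_bijective.1 s.encode_injective)).sum_comp g

/-! ### Successful decoding with ties counted as failures -/

/-- Every information bit `u i` is strictly more likely than its complement, given the channel
outputs and the true values of the previous bits. -/
def Succeeds : {n : ℕ} → PolarScheme n → Set (Fin (2 ^ n)) →
    (W : Fin (2 ^ n) → BinaryChannel.{u}) → (Fin (2 ^ n) → ZMod 2) →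
    ((j : Fin (2 ^ n)) → (W j).Out) → Prop
  | _, leaf, A, W, u, y => ∀ i ∈ A, (W i).law (u i + 1) (y i) < (W i).law (u i) (y i)
  | _, node π skip s₀ s₁, A, W, u, y =>
      s₀.Succeeds {i | lowPos i ∈ A} (firstBlock π skip W) (fun i => u (lowPos i))
        (fun i => firstOut (skip i) (y (π (evenPos i))) (y (π (oddPos i)))) ∧
      s₁.Succeeds {i | highPos i ∈ A} (secondBlock π skip W) (fun i => u (highPos i))
        (fun i => secondOut (skip i) (y (π (evenPos i))) (y (π (oddPos i)))
          (s₀.encode (fun i => u (lowPos i)) i))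

/-- As long as all earlier decisions are right, the decoder works with the true previous bits, so
the comparisons in `Succeeds` are the ones it makes. -/
theorem Succeeds.scDecode_eq {n : ℕ} {s : PolarScheme n} {A : Set (Fin (2 ^ n))}
    {W : Fin (2 ^ n) → BinaryChannel.{u}} {u : Fin (2 ^ n) → ZMod 2}
    {y : (j : Fin (2 ^ n)) → (W j).Out} (h : s.Succeeds A W u y) (hu : ∀ i, i ∉ A → u i = 0) :
    s.scDecode A W y = u := by
  induction s with
  | leaf =>
    funext i
    simp only [scDecode]
    by_cases hi : i ∈ A
    · have := h i hi
      rcases zmod_two_eq_zero_or_one (u i) with h0 | h1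
      · rw [h0, zero_add] at this
        rw [h0, if_neg fun hc => lt_asymm this hc.2]
      · rw [h1, zmod_two_add_self] at this
        rw [h1, if_pos ⟨hi, this⟩]
    · rw [hu i hi, if_neg fun hc => hi hc.1]
  | node π skip s₀ s₁ ih₀ ih₁ =>
    obtain ⟨h₀, h₁⟩ := h
    have e₀ := ih₀ h₀ fun i hi => hu _ hi
    have e₁ := ih₁ h₁ fun i hi => hu _ hi
    simp only [scDecode]
    rw [e₀, e₁]
    exact funext (forall_low_high (fun i => joinHalves_lowPos _ _ i)
      fun i => joinHalves_highPos _ _ i)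

/-- Translating the inputs by `w` and the outputs accordingly leaves each comparison unchanged. Ties
must count as failures for this: the rule that decodes a tie as 0 is not invariant. -/
theorem succeeds_add_iff {n : ℕ} (s : PolarScheme n) (A : Set (Fin (2 ^ n)))
    (W : Fin (2 ^ n) → BinaryChannel.{u}) (u w : Fin (2 ^ n) → ZMod 2)
    (y : (j : Fin (2 ^ n)) → (W j).Out) (τ : (j : Fin (2 ^ n)) → (W j).Out → (W j).Out)
    (hτ : ∀ j, (W j).Shifts (s.encode w j) (τ j)) :
    s.Succeeds A W (fun i => u i + w i) (fun j => τ j (y j)) ↔ s.Succeeds A W u y := by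
  induction s with
  | leaf =>
    refine forall₂_congr fun i _ => ?_
    have e₁ : (W i).law (u i + 1 + w i) (τ i (y i)) = _ := hτ i (u i + 1) (y i)
    have e₂ : (W i).law (u i + w i) (τ i (y i)) = _ := hτ i (u i) (y i)
    change (W i).law (u i + w i + 1) (τ i (y i)) < (W i).law (u i + w i) (τ i (y i)) ↔ _
    rw [add_right_comm, e₁, e₂]
  | node π skip s₀ s₁ ih₀ ih₁ =>
    have sh₀ : ∀ i, (W (π (evenPos i))).Shifts (if skip i then
        s₀.encode (fun i => w (lowPos i)) i else s₀.encode (fun i => w (lowPos i)) i +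
        s₁.encode (fun i => w (highPos i)) i) (τ (π (evenPos i))) := by
      intro i
      rw [← encode_node_even π skip s₀ s₁]
      exact hτ _
    have sh₁ : ∀ i, (W (π (oddPos i))).Shifts (s₁.encode (fun i => w (highPos i)) i)
        (τ (π (oddPos i))) := by
      intro i
      rw [← encode_node_odd π skip s₀ s₁]
      exact hτ _
    have i₀ := ih₀ {i | lowPos i ∈ A} (firstBlock π skip W) (fun i => u (lowPos i))
      (fun i => w (lowPos i)) (fun i => firstOut (skip i) (y (π (evenPos i))) (y (π (oddPos i))))
      (fun i => firstMap (skip i) (τ (π (evenPos i))) (τ (π (oddPos i))))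
      fun i => (sh₀ i).first (sh₁ i)
    have i₁ := ih₁ {i | highPos i ∈ A} (secondBlock π skip W) (fun i => u (highPos i))
      (fun i => w (highPos i)) (fun i => secondOut (skip i) (y (π (evenPos i)))
        (y (π (oddPos i))) (s₀.encode (fun i => u (lowPos i)) i))
      (fun i => secondMap (skip i) (τ (π (evenPos i))) (τ (π (oddPos i)))
        (s₀.encode (fun i => w (lowPos i)) i))
      fun i => (sh₀ i).second (sh₁ i)
    refine and_congr (Iff.trans (iff_of_eq ?_) i₀) (Iff.trans (iff_of_eq ?_) i₁)
    · congr 1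
      funext i
      cases skip i <;> rfl
    · congr 1
      funext i
      rw [s₀.encode_add (fun i => u (lowPos i)) (fun i => w (lowPos i))]
      cases skip i <;> rfl

open Classical in
/-- The probability that the information bits are not all strictly more likely than their
complements, when the vector `u` is encoded and sent. -/
def failure {n : ℕ} (s : PolarScheme n) (A : Set (Fin (2 ^ n)))
    (W : Fin (2 ^ n) → BinaryChannel.{u}) (u : Fin (2 ^ n) → ZMod 2) : ℝ≥0∞ :=
  ∑' y : (j : Fin (2 ^ n)) → (W j).Out,
    (∏ j, (W j).law (s.encode u j) (y j)) * if s.Succeeds A W u y then 0 else 1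

/-- The symmetries of the channels permute the output words and carry the law of the codeword of `u`
to that of `u + w`. -/
theorem failure_add {n : ℕ} (s : PolarScheme n) (A : Set (Fin (2 ^ n)))
    {W : Fin (2 ^ n) → BinaryChannel.{u}} (hW : ∀ j, (W j).IsSymmetric)
    (u w : Fin (2 ^ n) → ZMod 2) :
    s.failure A W (fun i => u i + w i) = s.failure A W u := by
  choose τ hτ using fun j => (hW j).exists_shifts (s.encode w j)
  rw [failure, ← (Equiv.piCongrRight τ).tsum_eq]
  refine tsum_congr fun y => ?_
  have e : (Equiv.piCongrRight τ) y = fun j => τ j (y j) := rfl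
  rw [e, encode_add]
  congr 1
  · exact Finset.prod_congr rfl fun j _ => hτ j _ _
  · have h := s.succeeds_add_iff A W u w y (fun j => τ j) hτ
    by_cases hs : s.Succeeds A W u y
    · rw [if_pos (h.2 hs), if_pos hs]
    · rw [if_neg (mt h.1 hs), if_neg hs]

theorem prod_encode_node {n : ℕ} (π : Equiv.Perm (Fin (2 ^ (n + 1)))) (skip : Fin (2 ^ n) → Bool)
    (s₀ s₁ : PolarScheme n) (W : Fin (2 ^ (n + 1)) → BinaryChannel.{u})
    (u : Fin (2 ^ (n + 1)) → ZMod 2) (y : (j : Fin (2 ^ (n + 1))) → (W j).Out) :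
    ∏ j, (W j).law ((node π skip s₀ s₁).encode u j) (y j) =
      ∏ i, (W (π (evenPos i))).law (if skip i then s₀.encode (fun i => u (lowPos i)) i
        else s₀.encode (fun i => u (lowPos i)) i + s₁.encode (fun i => u (highPos i)) i)
        (y (π (evenPos i))) *
        (W (π (oddPos i))).law (s₁.encode (fun i => u (highPos i)) i) (y (π (oddPos i))) := by
  rw [prod_perm_even_odd _ π]
  refine Finset.prod_congr rfl fun i _ => ?_
  rw [encode_node_even, encode_node_odd]

/-! ### Uniform inputs of one half induce the synthetic channels of the other -/

section Averaging

variable {n : ℕ} (π : Equiv.Perm (Fin (2 ^ (n + 1)))) (skip : Fin (2 ^ n) → Bool)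
  (W : Fin (2 ^ (n + 1)) → BinaryChannel.{u})

/-- After summation over all `v₁` the weight factorizes over the pairs, and each pair contributes
`sum_tsum_firstOut`. -/
theorem sum_tsum_firstBlock (v₀ : Fin (2 ^ n) → ZMod 2)
    (G : ((i : Fin (2 ^ n)) → (firstBlock π skip W i).Out) → ℝ≥0∞) :
    (∑ v₁ : Fin (2 ^ n) → ZMod 2, ∑' y : (j : Fin (2 ^ (n + 1))) → (W j).Out,
      (∏ i, (W (π (evenPos i))).law (if skip i then v₀ i else v₀ i + v₁ i) (y (π (evenPos i))) *
        (W (π (oddPos i))).law (v₁ i) (y (π (oddPos i)))) *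
      G fun i => firstOut (skip i) (y (π (evenPos i))) (y (π (oddPos i)))) =
    2 ^ 2 ^ n * ∑' z, (∏ i, (firstBlock π skip W i).law (v₀ i) (z i)) * G z := by
  classical
  have step : ∀ v₁ : Fin (2 ^ n) → ZMod 2, _ := fun v₁ =>
    ((pairEquiv (fun j => (W j).Out) π).tsum_eq (fun z :
      (i : Fin (2 ^ n)) → (W (π (evenPos i))).Out × (W (π (oddPos i))).Out =>
      (∏ i, (W (π (evenPos i))).law (if skip i then v₀ i else v₀ i + v₁ i) (z i).1 *
        (W (π (oddPos i))).law (v₁ i) (z i).2) *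
      G fun i => firstOut (skip i) (z i).1 (z i).2)).trans
    (ENNReal.tsum_prod_mul_comp
      (fun i (z : (W (π (evenPos i))).Out × (W (π (oddPos i))).Out) =>
        firstOut (skip i) z.1 z.2)
      (fun i (z : (W (π (evenPos i))).Out × (W (π (oddPos i))).Out) =>
        (W (π (evenPos i))).law (if skip i then v₀ i else v₀ i + v₁ i) z.1 *
        (W (π (oddPos i))).law (v₁ i) z.2) G)
  refine (Finset.sum_congr rfl fun v₁ _ => step v₁).trans ?_
  rw [← Summable.tsum_finsetSum fun _ _ => ENNReal.summable, ← ENNReal.tsum_mul_left]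
  refine tsum_congr fun z => ?_
  rw [← Finset.sum_mul, ← mul_assoc]
  congr 1
  have := Fintype.prod_sum (fun (i : Fin (2 ^ n)) (x : ZMod 2) =>
    ∑' p : (W (π (evenPos i))).Out × (W (π (oddPos i))).Out,
      if firstOut (skip i) p.1 p.2 = z i then
        (W (π (evenPos i))).law (if skip i then v₀ i else v₀ i + x) p.1 *
          (W (π (oddPos i))).law x p.2 else 0)
  refine this.symm.trans ((Finset.prod_congr rfl fun i _ =>
    sum_tsum_firstOut (skip i) _ _ (v₀ i) (z i)).trans ?_)
  rw [Finset.prod_mul_distrib]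
  simp only [Finset.prod_const, Finset.card_univ, Fintype.card_fin]
  rfl

/-- The same factorization, with `v₀` both summed over and visible in the output, as in ⊛. -/
theorem sum_tsum_secondBlock (v₁ : Fin (2 ^ n) → ZMod 2)
    (G : ((i : Fin (2 ^ n)) → (secondBlock π skip W i).Out) → ℝ≥0∞) :
    (∑ v₀ : Fin (2 ^ n) → ZMod 2, ∑' y : (j : Fin (2 ^ (n + 1))) → (W j).Out,
      (∏ i, (W (π (evenPos i))).law (if skip i then v₀ i else v₀ i + v₁ i) (y (π (evenPos i))) *
        (W (π (oddPos i))).law (v₁ i) (y (π (oddPos i)))) *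
      G fun i => secondOut (skip i) (y (π (evenPos i))) (y (π (oddPos i))) (v₀ i)) =
    2 ^ 2 ^ n * ∑' z, (∏ i, (secondBlock π skip W i).law (v₁ i) (z i)) * G z := by
  classical
  have step : ∀ v₀ : Fin (2 ^ n) → ZMod 2, _ := fun v₀ =>
    ((pairEquiv (fun j => (W j).Out) π).tsum_eq (fun z :
      (i : Fin (2 ^ n)) → (W (π (evenPos i))).Out × (W (π (oddPos i))).Out =>
      (∏ i, (W (π (evenPos i))).law (if skip i then v₀ i else v₀ i + v₁ i) (z i).1 *
        (W (π (oddPos i))).law (v₁ i) (z i).2) *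
      G fun i => secondOut (skip i) (z i).1 (z i).2 (v₀ i))).trans
    (ENNReal.tsum_prod_mul_comp
      (fun i (z : (W (π (evenPos i))).Out × (W (π (oddPos i))).Out) =>
        secondOut (skip i) z.1 z.2 (v₀ i))
      (fun i (z : (W (π (evenPos i))).Out × (W (π (oddPos i))).Out) =>
        (W (π (evenPos i))).law (if skip i then v₀ i else v₀ i + v₁ i) z.1 *
        (W (π (oddPos i))).law (v₁ i) z.2) G)
  refine (Finset.sum_congr rfl fun v₀ _ => step v₀).trans ?_
  rw [← Summable.tsum_finsetSum fun _ _ => ENNReal.summable, ← ENNReal.tsum_mul_left]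
  refine tsum_congr fun z => ?_
  rw [← Finset.sum_mul, ← mul_assoc]
  congr 1
  have := Fintype.prod_sum (fun (i : Fin (2 ^ n)) (x : ZMod 2) =>
    ∑' p : (W (π (evenPos i))).Out × (W (π (oddPos i))).Out,
      if secondOut (skip i) p.1 p.2 x = z i then
        (W (π (evenPos i))).law (if skip i then x else x + v₁ i) p.1 *
          (W (π (oddPos i))).law (v₁ i) p.2 else 0)
  refine this.symm.trans ((Finset.prod_congr rfl fun i _ =>
    sum_tsum_secondOut (skip i) _ _ (v₁ i) (z i)).trans ?_)
  rw [Finset.prod_mul_distrib]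
  simp only [Finset.prod_const, Finset.card_univ, Fintype.card_fin]
  rfl

end Averaging

open Classical in
-- A node fails only if one of its halves fails given the true previous bits. The encoder of the
-- other half is a bijection, so its code bits range over all vectors and the averaging lemmas
-- apply.
theorem sum_failure_le {n : ℕ} (s : PolarScheme n) (A : Set (Fin (2 ^ n)))
    (W : Fin (2 ^ n) → BinaryChannel.{u}) :
    ∑ u, s.failure A W u ≤ 2 ^ 2 ^ n *
      ∑ i, if i ∈ A then ENNReal.ofReal (s.bitChannel W i).bhattacharyya else 0 := by
  induction s with
  | leaf =>
    let _ : Unique (Fin (2 ^ 0)) := inferInstanceAs (Unique (Fin 1))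
    have hR : (∑ i, if i ∈ A then ENNReal.ofReal (leaf.bitChannel W i).bhattacharyya else 0) =
        if default ∈ A then ENNReal.ofReal (W default).bhattacharyya else 0 :=
      Fintype.sum_unique _
    rw [hR, ← (Equiv.funUnique (Fin (2 ^ 0)) (ZMod 2)).symm.sum_comp, sum_zmod_two,
      show (2 : ℝ≥0∞) ^ 2 ^ 0 = 2 by norm_num, two_mul]
    have key : ∀ x : ZMod 2, leaf.failure A W ((Equiv.funUnique (Fin (2 ^ 0)) (ZMod 2)).symm x) ≤
        if default ∈ A then ENNReal.ofReal (W default).bhattacharyya else 0 := by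
      intro x
      rw [failure, ← (Equiv.piUnique fun j => (W j).Out).symm.tsum_eq]
      split_ifs with h
      · refine le_trans (le_of_eq (tsum_congr fun y => ?_))
          ((W default).tsum_error_le_bhattacharyya x)
        rw [Fintype.prod_unique]
        congr 1
        refine if_congr ?_ rfl rfl
        constructor
        · exact fun hs => hs default h
        · intro hs i _
          obtain rfl := Unique.eq_default i
          exact hs
      · refine le_of_eq (ENNReal.tsum_eq_zero.2 fun y => ?_)
        rw [if_pos, mul_zero]
        intro i hi
        obtain rfl := Unique.eq_default i
        exact absurd hi h
    exact add_le_add (key 0) (key 1)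
  | @node n π skip s₀ s₁ ih₀ ih₁ =>
    set G₀ := fun (u₀ : Fin (2 ^ n) → ZMod 2) z =>
      if s₀.Succeeds {i | lowPos i ∈ A} (firstBlock π skip W) u₀ z then (0 : ℝ≥0∞) else 1 with hG₀
    set G₁ := fun (u₁ : Fin (2 ^ n) → ZMod 2) z =>
      if s₁.Succeeds {i | highPos i ∈ A} (secondBlock π skip W) u₁ z then (0 : ℝ≥0∞) else 1
      with hG₁
    set P := fun (v₀ v₁ : Fin (2 ^ n) → ZMod 2) (y : (j : Fin (2 ^ (n + 1))) → (W j).Out) =>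
      ∏ i, (W (π (evenPos i))).law (if skip i then v₀ i else v₀ i + v₁ i) (y (π (evenPos i))) *
        (W (π (oddPos i))).law (v₁ i) (y (π (oddPos i))) with hP
    set T₀ := fun (u₀ v₀ v₁ : Fin (2 ^ n) → ZMod 2) =>
      ∑' y : (j : Fin (2 ^ (n + 1))) → (W j).Out, P v₀ v₁ y *
        G₀ u₀ fun i => firstOut (skip i) (y (π (evenPos i))) (y (π (oddPos i))) with hT₀
    set T₁ := fun (u₁ v₀ v₁ : Fin (2 ^ n) → ZMod 2) =>
      ∑' y : (j : Fin (2 ^ (n + 1))) → (W j).Out, P v₀ v₁ y *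
        G₁ u₁ fun i => secondOut (skip i) (y (π (evenPos i))) (y (π (oddPos i))) (v₀ i) with hT₁
    have hite : ∀ r p q : Prop, (r ↔ p ∧ q) → (if r then (0 : ℝ≥0∞) else 1) ≤
        (if p then 0 else 1) + if q then 0 else 1 := by
      intro r p q h
      by_cases hp : p <;> by_cases hq : q <;> simp [h, hp, hq]
    have h1 : ∀ u, (node π skip s₀ s₁).failure A W u ≤
        (fun a b => T₀ a (s₀.encode a) (s₁.encode b) + T₁ b (s₀.encode a) (s₁.encode b))
          (fun i => u (lowPos i)) (fun i => u (highPos i)) := by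
      intro u
      simp only [hT₀, hT₁, failure]
      rw [← ENNReal.tsum_add]
      refine ENNReal.tsum_le_tsum fun y => ?_
      rw [prod_encode_node, ← mul_add]
      refine mul_le_mul' le_rfl ?_
      exact hite _ _ _ Iff.rfl
    refine (Finset.sum_le_sum fun u _ => h1 u).trans ((sum_halves fun a b =>
      T₀ a (s₀.encode a) (s₁.encode b) + T₁ b (s₀.encode a) (s₁.encode b)).trans_le ?_)
    simp only [Finset.sum_add_distrib]
    rw [Finset.sum_comm (f := fun a b => T₁ b (s₀.encode a) (s₁.encode b))]
    have e₀ : ∀ a, ∑ b, T₀ a (s₀.encode a) (s₁.encode b) =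
        2 ^ 2 ^ n * s₀.failure {i | lowPos i ∈ A} (firstBlock π skip W) a := fun a =>
      (s₁.sum_encode fun v => T₀ a (s₀.encode a) v).trans
        (sum_tsum_firstBlock π skip W (s₀.encode a) (G₀ a))
    have e₁ : ∀ b, ∑ a, T₁ b (s₀.encode a) (s₁.encode b) =
        2 ^ 2 ^ n * s₁.failure {i | highPos i ∈ A} (secondBlock π skip W) b := fun b =>
      (s₀.sum_encode fun v => T₁ b v (s₁.encode b)).trans
        (sum_tsum_secondBlock π skip W (s₁.encode b) (G₁ b))
    rw [Finset.sum_congr rfl fun a _ => e₀ a, Finset.sum_congr rfl fun b _ => e₁ b,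
      ← Finset.mul_sum, ← Finset.mul_sum, ← mul_add]
    have e2 : (2 : ℝ≥0∞) ^ 2 ^ (n + 1) = 2 ^ 2 ^ n * 2 ^ 2 ^ n := by
      rw [← pow_add, pow_succ, mul_two]
    rw [e2, mul_assoc]
    refine mul_le_mul' le_rfl ((add_le_add (ih₀ _ _) (ih₁ _ _)).trans_eq ?_)
    rw [← mul_add, sum_low_high]
    simp [bitChannel]

end PolarScheme

/-- The block error probability of a polar code is at most the sum of the Bhattacharyya parameters
of its information bit-channels. -/
theorem PolarCode.blockError_le {n : ℕ} {W : Fin (2 ^ n) → BinaryChannel.{u}} (C : PolarCode W)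
    (hW : ∀ j, (W j).IsSymmetric) :
    C.blockError ≤ ∑ i ∈ C.info, ENNReal.ofReal (C.scheme.bitChannel W i).bhattacharyya := by
  classical
  set S := ∑ i ∈ C.info, ENNReal.ofReal (C.scheme.bitChannel W i).bhattacharyya with hS
  set A : Set (Fin (2 ^ n)) := (C.info : Set (Fin (2 ^ n))) with hA
  -- By symmetry one vector fails as often as the average vector, frozen positions included.
  have hconst : ∀ m, C.scheme.failure A W m = C.scheme.failure A W 0 := fun m => by
    simpa using C.scheme.failure_add A hW 0 m
  have hle : C.scheme.failure A W 0 ≤ S := by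
    have h := (C.scheme.sum_failure_le A W).trans_eq (congrArg _
      ((Finset.sum_subset (Finset.subset_univ C.info) fun i _ hi => if_neg hi).symm.trans
        (Finset.sum_congr rfl fun i hi => if_pos hi)))
    rw [Finset.sum_congr rfl fun m _ => hconst m, Finset.sum_const, Finset.card_univ, nsmul_eq_mul] at h
    have hc : ((Fintype.card (Fin (2 ^ n) → ZMod 2) : ℕ) : ℝ≥0∞) = 2 ^ 2 ^ n := by
      simp [ZMod.card]
    rw [hc] at h
    exact (ENNReal.mul_le_mul_iff_right (by positivity) (by simp)).1 h
  refine ENNReal.div_le_of_le_mul ?_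
  rw [mul_comm, ← nsmul_eq_mul, ← Finset.sum_const]
  refine Finset.sum_le_sum fun m hm => le_trans ?_ ((hconst m).trans_le hle)
  refine ENNReal.tsum_le_tsum fun y => ?_
  have hm' : ∀ i, i ∉ A → m i = 0 := by
    simpa [PolarCode.messages, hA] using hm
  by_cases hs : C.scheme.Succeeds A W m y
  · rw [if_pos (show C.decode y = m from hs.scDecode_eq hm')]
    exact zero_le
  · rw [if_neg hs, mul_one]
    split_ifs
    · exact zero_le
    · exact le_rfl

/-! ### Straight-line computations -/

section Computes

variable {Y : Type*}

/-- The function `f` results from functions in `T` by one elementary operation. -/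
inductive RealStep (T : Set (Y → ℝ)) : (Y → ℝ) → Prop
  | const (c : ℚ) : RealStep T fun _ => (c : ℝ)
  | add {f g : Y → ℝ} : f ∈ T → g ∈ T → RealStep T fun y => f y + g y
  | sub {f g : Y → ℝ} : f ∈ T → g ∈ T → RealStep T fun y => f y - g y
  | mul {f g : Y → ℝ} : f ∈ T → g ∈ T → RealStep T fun y => f y * g y
  | less {f g h : Y → ℝ} : f ∈ T → g ∈ T → (∀ y, f y < g y → h y = 1) →
      (∀ y, ¬ f y < g y → h y = 0) → RealStep T h

/-- Starting with the functions in `S`, those in `T` are obtained by `t` elementary operations. -/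
inductive Derives (S : Set (Y → ℝ)) : ℕ → Set (Y → ℝ) → Prop
  | refl : Derives S 0 S
  | step {t : ℕ} {T : Set (Y → ℝ)} {f : Y → ℝ} : Derives S t T → RealStep T f →
      Derives S (t + 1) (insert f T)

/-- All functions in `T` are computed from those in `S` in at most `t` elementary operations. -/
def Computes (S : Set (Y → ℝ)) (t : ℕ) (T : Set (Y → ℝ)) : Prop :=
  ∃ t' ≤ t, ∃ U, Derives S t' U ∧ T ⊆ U

variable {S S' T T' U : Set (Y → ℝ)} {t t' : ℕ} {f g : Y → ℝ}

theorem RealStep.mono (h : RealStep T f) (hT : T ⊆ U) : RealStep U f := by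
  cases h with
  | const c => exact .const c
  | add hf hg => exact .add (hT hf) (hT hg)
  | sub hf hg => exact .sub (hT hf) (hT hg)
  | mul hf hg => exact .mul (hT hf) (hT hg)
  | less hf hg h₁ h₀ => exact .less (hT hf) (hT hg) h₁ h₀

theorem Derives.subset (h : Derives S t T) : S ⊆ T := by
  induction h with
  | refl => exact subset_rfl
  | step _ _ ih => exact ih.trans (Set.subset_insert _ _)

theorem Derives.trans (h : Derives S t T) (h' : Derives T t' U) : Derives S (t + t') U := by
  induction h' with
  | refl => exact h
  | step _ hf ih => exact ih.step hf

theorem Derives.mono (h : Derives S t T) (hS : S ⊆ S') : Derives S' t (T ∪ S') := by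
  induction h with
  | refl => rw [Set.union_eq_right.2 hS]; exact .refl
  | step _ hf ih =>
    rw [Set.insert_union]
    exact ih.step (hf.mono Set.subset_union_left)

theorem Computes.mono (h : Computes S t T) (hS : S ⊆ S') (ht : t ≤ t') (hT : T' ⊆ T) :
    Computes S' t' T' := by
  obtain ⟨k, hk, U, hU, hTU⟩ := h
  exact ⟨k, hk.trans ht, _, hU.mono hS, hT.trans (hTU.trans Set.subset_union_left)⟩

theorem Computes.of_subset (h : T ⊆ S) : Computes S 0 T := ⟨0, le_rfl, S, .refl, h⟩

theorem Computes.trans (h : Computes S t T) (h' : Computes (S ∪ T) t' T') :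
    Computes S (t + t') (S ∪ T ∪ T') := by
  obtain ⟨k, hk, U, hU, hTU⟩ := h
  obtain ⟨k', hk', V, hV, hTV⟩ := h'
  have hS : S ∪ T ⊆ U := Set.union_subset hU.subset hTU
  exact ⟨k + k', add_le_add hk hk', _, hU.trans (hV.mono hS),
    Set.union_subset (hS.trans Set.subset_union_right) (hTV.trans Set.subset_union_left)⟩

theorem Computes.union (h : Computes S t T) (h' : Computes S t' T') :
    Computes S (t + t') (T ∪ T') :=
  (h.trans (h'.mono Set.subset_union_left le_rfl subset_rfl)).mono subset_rfl le_rfl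
    (Set.union_subset_union_left _ Set.subset_union_right)

theorem Computes.step (h : Computes S t T) (hf : RealStep T f) : Computes S (t + 1) {f} := by
  obtain ⟨k, hk, U, hU, hTU⟩ := h
  exact ⟨k + 1, by omega, _, hU.step (hf.mono hTU), by simp⟩

theorem Computes.of_mem (h : f ∈ S) : Computes S 0 {f} :=
  .of_subset (Set.singleton_subset_iff.2 h)

theorem Computes.const (c : ℚ) : Computes S 1 {fun _ => (c : ℝ)} :=
  (Computes.of_subset (Set.empty_subset S)).step (.const c)

theorem Computes.add (hf : Computes S t {f}) (hg : Computes S t' {g}) :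
    Computes S (t + t' + 1) {fun y => f y + g y} :=
  (hf.union hg).step (.add (by simp) (by simp))

theorem Computes.sub (hf : Computes S t {f}) (hg : Computes S t' {g}) :
    Computes S (t + t' + 1) {fun y => f y - g y} :=
  (hf.union hg).step (.sub (by simp) (by simp))

theorem Computes.mul (hf : Computes S t {f}) (hg : Computes S t' {g}) :
    Computes S (t + t' + 1) {fun y => f y * g y} :=
  (hf.union hg).step (.mul (by simp) (by simp))

theorem Computes.biUnion {ι : Type*} {F : ι → Y → ℝ} {c : ℕ} (h : ∀ i, Computes S c {F i})
    (s : Finset ι) : Computes S (s.card * c) (⋃ i ∈ s, {F i}) := by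
  classical
  induction s using Finset.induction_on with
  | empty => simpa using Computes.of_subset (Set.empty_subset S)
  | insert a s ha ih =>
    rw [Finset.card_insert_of_notMem ha, add_mul, one_mul, add_comm, Finset.set_biUnion_insert]
    exact (h a).union ih

theorem Computes.range {ι : Type*} [Fintype ι] {F : ι → Y → ℝ} {c : ℕ}
    (h : ∀ i, Computes S c {F i}) : Computes S (Fintype.card ι * c) (Set.range F) := by
  refine (Computes.biUnion h Finset.univ).mono subset_rfl le_rfl ?_
  rintro _ ⟨i, rfl⟩
  simp

/-- A straight-line computation is carried out by a program. -/
theorem Derives.exists_program (h : Derives S t T) (r : Y → ℕ → ℝ) (b : ℕ)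
    (hr : ∀ f ∈ S, ∃ k < b, ∀ y, r y k = f y) :
    ∃ (p : RealProgram) (b' : ℕ), p.length ≤ t ∧
      ∀ f ∈ T, ∃ k < b', ∀ y, p.run (r y) k = f y := by
  induction h with
  | refl => exact ⟨[], b, le_rfl, hr⟩
  | @step t T f _ hf ih =>
    obtain ⟨p, b', hp, hT⟩ := ih
    obtain ⟨op, hop⟩ : ∃ op : RealOp, ∀ y, op.eval (p.run (r y)) = f y := by
      cases hf with
      | const c => exact ⟨.const c, fun _ => rfl⟩
      | add hf hg =>
        obtain ⟨k, -, hk⟩ := hT _ hf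
        obtain ⟨l, -, hl⟩ := hT _ hg
        exact ⟨.add k l, fun y => by rw [RealOp.eval, hk, hl]⟩
      | sub hf hg =>
        obtain ⟨k, -, hk⟩ := hT _ hf
        obtain ⟨l, -, hl⟩ := hT _ hg
        exact ⟨.sub k l, fun y => by rw [RealOp.eval, hk, hl]⟩
      | mul hf hg =>
        obtain ⟨k, -, hk⟩ := hT _ hf
        obtain ⟨l, -, hl⟩ := hT _ hg
        exact ⟨.mul k l, fun y => by rw [RealOp.eval, hk, hl]⟩
      | less hf hg h₁ h₀ =>
        obtain ⟨k, -, hk⟩ := hT _ hf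
        obtain ⟨l, -, hl⟩ := hT _ hg
        refine ⟨.less k l, fun y => ?_⟩
        rw [RealOp.eval, hk, hl]
        split_ifs with hlt
        exacts [(h₁ y hlt).symm, (h₀ y hlt).symm]
    -- The result goes to the fresh register `b'`, so no earlier value is overwritten.
    have hrun : ∀ y, RealProgram.run (p ++ [(b', op)]) (r y) =
        Function.update (p.run (r y)) b' (op.eval (p.run (r y))) := fun y => by
      simp [RealProgram.run]
    refine ⟨p ++ [(b', op)], b' + 1, by simpa using hp, ?_⟩
    rintro g (rfl | hg)
    · exact ⟨b', by omega, fun y => by rw [hrun, Function.update_self, hop]⟩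
    · obtain ⟨k, hk, hkg⟩ := hT g hg
      exact ⟨k, by omega, fun y => by rw [hrun, Function.update_of_ne hk.ne, hkg]⟩

end Computes

/-! ### The running time of successive cancellation decoding -/

/-- A bit as a real number. -/
def bitValue (x : ZMod 2) : ℝ := if x = 1 then 1 else 0

@[simp] theorem bitValue_zero : bitValue 0 = 0 := by simp [bitValue]
@[simp] theorem bitValue_one : bitValue 1 = 1 := by simp [bitValue]

theorem bitValue_add (x y : ZMod 2) :
    bitValue (x + y) = (bitValue x - bitValue y) * (bitValue x - bitValue y) := by
  rcases zmod_two_eq_zero_or_one x with rfl | rfl <;>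
  rcases zmod_two_eq_zero_or_one y with rfl | rfl <;> simp [zmod_two_add_self]

namespace BinaryChannel

variable {Y : Type*} {S : Set (Y → ℝ)} {W₁ W₂ : BinaryChannel.{u}} {y₁ : Y → W₁.Out}
  {y₂ : Y → W₂.Out}

theorem computes_first (h₁ : ∀ x, (fun ω => W₁.prob (y₁ ω) x) ∈ S)
    (h₂ : ∀ x, (fun ω => W₂.prob (y₂ ω) x) ∈ S) (skip : Bool) (x : ZMod 2) :
    Computes S 5 {fun ω => (first skip W₁ W₂).prob (firstOut skip (y₁ ω) (y₂ ω)) x} := by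
  cases skip
  · have h := (Computes.const (S := S) (1 / 2)).mul (((Computes.of_mem (h₁ x)).mul
      (Computes.of_mem (h₂ 0))).add ((Computes.of_mem (h₁ (x + 1))).mul (Computes.of_mem (h₂ 1))))
    refine h.mono subset_rfl (by norm_num) (Set.singleton_subset_singleton.2 (funext fun ω => ?_))
    push_cast
    rcases zmod_two_eq_zero_or_one x with rfl | rfl
    · rw [zero_add]
      exact prob_minus_zero W₁ W₂ _ _
    · rw [zmod_two_add_self]
      exact prob_minus_one W₁ W₂ _ _
  · exact (Computes.of_mem (h₁ x)).mono subset_rfl (by norm_num) subset_rfl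

/-- The likelihood of `W₁` at the data-dependent input `v + x` is selected without branching, by
interpolation: p(x) + v (p(x + 1) - p(x)). -/
theorem computes_second (h₁ : ∀ x, (fun ω => W₁.prob (y₁ ω) x) ∈ S)
    (h₂ : ∀ x, (fun ω => W₂.prob (y₂ ω) x) ∈ S) {v : Y → ZMod 2}
    (hv : (fun ω => bitValue (v ω)) ∈ S) (skip : Bool) (x : ZMod 2) :
    Computes S 6
      {fun ω => (second skip W₁ W₂).prob (secondOut skip (y₁ ω) (y₂ ω) (v ω)) x} := by
  cases skip
  · have h := (Computes.const (S := S) (1 / 2)).mul (((Computes.of_mem (h₁ x)).add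
      ((Computes.of_mem hv).mul ((Computes.of_mem (h₁ (x + 1))).sub (Computes.of_mem (h₁ x))))).mul
        (Computes.of_mem (h₂ x)))
    refine h.mono subset_rfl (by norm_num) (Set.singleton_subset_singleton.2 (funext fun ω => ?_))
    refine (prob_plus W₁ W₂ (y₁ ω) (y₂ ω) (v ω) x).trans ?_
    push_cast
    congr 2
    rcases zmod_two_eq_zero_or_one (v ω) with h0 | h0
    · simp [h0]
    · simp [h0, add_comm]
  · exact (Computes.of_mem (h₂ x)).mono subset_rfl (by norm_num) subset_rfl

end BinaryChannel

open BinaryChannel in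
/-- The decoded bits and the corresponding code bits are computed jointly. -/
theorem PolarScheme.computes_scDecode {n : ℕ} (s : PolarScheme n) (A : Set (Fin (2 ^ n)))
    (W : Fin (2 ^ n) → BinaryChannel.{u}) {Y : Type*} (y : Y → (j : Fin (2 ^ n)) → (W j).Out)
    (S : Set (Y → ℝ)) (hS : ∀ j x, (fun ω => (W j).prob (y ω j) x) ∈ S) :
    Computes S ((1 + 13 * n) * 2 ^ n)
      (Set.range (fun i ω => bitValue (s.scDecode A W (y ω) i)) ∪
        Set.range (fun i ω => bitValue (s.encode (s.scDecode A W (y ω)) i))) := by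
  induction s generalizing S with
  | leaf =>
    have key : ∀ i, Computes S 1 {fun ω => bitValue (leaf.scDecode A W (y ω) i)} := by
      intro i
      by_cases hi : i ∈ A
      · refine (Computes.of_subset (T := S) subset_rfl).step (.less (hS i 0) (hS i 1) ?_ ?_)
        · intro ω h
          have h' := (ENNReal.toReal_lt_toReal ((W i).law 0 |>.apply_ne_top _)
            ((W i).law 1 |>.apply_ne_top _)).1 h
          simp [scDecode, hi, h']
        · intro ω h
          have h' := mt (ENNReal.toReal_lt_toReal ((W i).law 0 |>.apply_ne_top _)
            ((W i).law 1 |>.apply_ne_top _)).2 h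
          simp only [scDecode]
          rw [if_neg fun hc => h' hc.2, bitValue_zero]
      · refine (Computes.const 0).mono subset_rfl le_rfl
          (Set.singleton_subset_singleton.2 (funext fun ω => ?_))
        simp [scDecode, hi]
    refine (Computes.range key).mono subset_rfl (by simp) (Set.union_subset subset_rfl subset_rfl)
  | @node n π skip s₀ s₁ ih₀ ih₁ =>
    set y₀ : Y → (i : Fin (2 ^ n)) → (firstBlock π skip W i).Out := fun ω i =>
      firstOut (skip i) (y ω (π (evenPos i))) (y ω (π (oddPos i))) with hy₀
    set u₀ := fun ω => s₀.scDecode {i | lowPos i ∈ A} (firstBlock π skip W) (y₀ ω) with hu₀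
    set v₀ := fun ω => s₀.encode (u₀ ω) with hv₀
    set y₁ : Y → (i : Fin (2 ^ n)) → (secondBlock π skip W i).Out := fun ω i =>
      secondOut (skip i) (y ω (π (evenPos i))) (y ω (π (oddPos i))) (v₀ ω i) with hy₁
    set u₁ := fun ω => s₁.scDecode {i | highPos i ∈ A} (secondBlock π skip W) (y₁ ω) with hu₁
    set v₁ := fun ω => s₁.encode (u₁ ω) with hv₁
    have hdec : ∀ ω, (node π skip s₀ s₁).scDecode A W (y ω) = joinHalves (u₀ ω) (u₁ ω) :=
      fun ω => rfl
    have c₁ := Computes.range (S := S) (F := fun (p : Fin (2 ^ n) × ZMod 2) ω =>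
      (firstBlock π skip W p.1).prob (y₀ ω p.1) p.2)
      fun p => computes_first (hS _) (hS _) (skip p.1) p.2
    have c₂ := ih₀ {i | lowPos i ∈ A} (firstBlock π skip W) y₀ (S ∪ Set.range
      fun (p : Fin (2 ^ n) × ZMod 2) ω => (firstBlock π skip W p.1).prob (y₀ ω p.1) p.2)
      fun j x => Or.inr ⟨(j, x), rfl⟩
    have d₂ := c₁.trans c₂
    set S₂ := _ ∪ _ ∪ (Set.range (fun i ω => bitValue (u₀ ω i)) ∪
      Set.range fun i ω => bitValue (v₀ ω i)) with hS₂
    have hS₂S : S ⊆ S₂ := fun f hf => Or.inl (Or.inl hf)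
    have c₃ := Computes.range (S := S ∪ S₂) (F := fun (p : Fin (2 ^ n) × ZMod 2) ω =>
      (secondBlock π skip W p.1).prob (y₁ ω p.1) p.2)
      fun p => computes_second (fun x => Or.inl (hS _ x)) (fun x => Or.inl (hS _ x))
        (Or.inr (Or.inr (Or.inr ⟨p.1, rfl⟩))) (skip p.1) p.2
    have d₃ := d₂.trans c₃
    set S₃ := S ∪ S₂ ∪ _ with hS₃
    have c₄ := ih₁ {i | highPos i ∈ A} (secondBlock π skip W) y₁ (S ∪ S₃)
      fun j x => Or.inr (Or.inr ⟨(j, x), rfl⟩)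
    have d₄ := d₃.trans c₄
    set S₄ := S ∪ S₃ ∪ (Set.range (fun i ω => bitValue (u₁ ω i)) ∪
      Set.range fun i ω => bitValue (v₁ ω i)) with hS₄
    have hu₀S : ∀ i, (fun ω => bitValue (u₀ ω i)) ∈ S₄ := fun i =>
      Or.inl (Or.inr (Or.inl (Or.inr (Or.inr (Or.inl ⟨i, rfl⟩)))))
    have hv₀S : ∀ i, (fun ω => bitValue (v₀ ω i)) ∈ S₄ := fun i =>
      Or.inl (Or.inr (Or.inl (Or.inr (Or.inr (Or.inr ⟨i, rfl⟩)))))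
    have hu₁S : ∀ i, (fun ω => bitValue (u₁ ω i)) ∈ S₄ := fun i => Or.inr (Or.inl ⟨i, rfl⟩)
    have hv₁S : ∀ i, (fun ω => bitValue (v₁ ω i)) ∈ S₄ := fun i => Or.inr (Or.inr ⟨i, rfl⟩)
    have c₅ := Computes.range (S := S ∪ S₄) (c := 3) (F := fun (i : Fin (2 ^ n)) ω =>
      bitValue (if skip i then v₀ ω i else v₀ ω i + v₁ ω i)) (by
        intro i
        cases skip i
        · have hd := (Computes.of_mem (Set.mem_union_right S (hv₀S i))).sub
            (Computes.of_mem (Set.mem_union_right S (hv₁S i)))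
          refine (hd.mul hd).mono subset_rfl (by norm_num)
            (Set.singleton_subset_singleton.2 (funext fun ω => ?_))
          exact bitValue_add _ _
        · exact (Computes.of_mem (Set.mem_union_right S (hv₀S i))).mono subset_rfl (by norm_num)
            subset_rfl)
    refine (d₄.trans c₅).mono subset_rfl ?_ ?_
    -- Each pair costs 2 · 5 + 2 · 6 operations for the likelihoods and 3 for re-encoding: 25,
    -- within the 26 = 2 · 13 allowed.
    · simp only [Fintype.card_prod, Fintype.card_fin, ZMod.card]
      ring_nf
      nlinarith [Nat.zero_le (2 ^ n)]
    · refine Set.union_subset ?_ ?_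
      · rintro _ ⟨k, rfl⟩
        simp only [hdec]
        revert k
        refine forall_low_high (fun i => ?_) (fun i => ?_)
        · simp only [joinHalves_lowPos]
          exact Or.inl (Or.inr (hu₀S i))
        · simp only [joinHalves_highPos]
          exact Or.inl (Or.inr (hu₁S i))
      · rintro _ ⟨k, rfl⟩
        simp only [hdec]
        obtain ⟨k, rfl⟩ := π.surjective k
        revert k
        refine forall_even_odd (fun i => ?_) (fun i => ?_)
        · simp only [encode_node_even, joinHalves_lowPos, joinHalves_highPos]
          exact Or.inr ⟨i, rfl⟩
        · simp only [encode_node_odd, joinHalves_highPos]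
          exact Or.inl (Or.inr (hv₁S i))

theorem likelihoodRegisters_eq {N : ℕ} (W : Fin N → BinaryChannel.{u})
    (y : (j : Fin N) → (W j).Out) {k : ℕ} {j : Fin N} {x : ZMod 2} (hj : k / 2 = j)
    (hx : (k : ZMod 2) = x) : likelihoodRegisters W y k = (W j).prob (y j) x := by
  obtain ⟨j, hjN⟩ := j
  dsimp only at hj
  subst hj hx
  rw [likelihoodRegisters, dif_pos hjN]

/-- The successive cancellation decoder of a polar code of length `2 ^ n` runs in time
`O(n 2 ^ n)`. -/
theorem PolarCode.decodableIn {n : ℕ} {W : Fin (2 ^ n) → BinaryChannel.{u}} (C : PolarCode W) :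
    C.DecodableIn ((1 + 13 * n) * 2 ^ n) := by
  obtain ⟨t, ht, U, hU, hsub⟩ := C.scheme.computes_scDecode (C.info : Set (Fin (2 ^ n))) W
    (Y := (j : Fin (2 ^ n)) → (W j).Out) id
    (Set.range fun (p : Fin (2 ^ n) × ZMod 2) y => (W p.1).prob (y p.1) p.2)
    fun j x => ⟨(j, x), rfl⟩
  obtain ⟨p, b, hp, hb⟩ := hU.exists_program (likelihoodRegisters W) (2 * 2 ^ n) (by
    rintro _ ⟨⟨j, x⟩, rfl⟩
    have hj := j.isLt
    rcases zmod_two_eq_zero_or_one x with rfl | rfl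
    · refine ⟨2 * j, by omega, fun y => likelihoodRegisters_eq W y (j := j) (by omega) ?_⟩
      rw [Nat.cast_mul, show ((2 : ℕ) : ZMod 2) = 0 from rfl, zero_mul]
    · refine ⟨2 * j + 1, by omega, fun y => likelihoodRegisters_eq W y (j := j) (by omega) ?_⟩
      rw [Nat.cast_add, Nat.cast_mul, show ((2 : ℕ) : ZMod 2) = 0 from rfl, zero_mul, zero_add,
        Nat.cast_one])
  choose out _ hout using fun i => hb _ (hsub (Or.inl ⟨i, rfl⟩))
  exact ⟨p, out, hp.trans ht, fun y i => hout i y⟩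

/-! ### The coding theorem -/

theorem exists_finset_card_eq_forall_le {ι : Type*} [Fintype ι] (f : ι → ℝ) {k : ℕ}
    (hk : k ≤ Fintype.card ι) :
    ∃ A : Finset ι, A.card = k ∧ ∀ i ∈ A, ∀ j, j ∉ A → f i ≤ f j := by
  classical
  induction k with
  | zero => exact ⟨∅, by simp⟩
  | succ k ih =>
    obtain ⟨A, hA, hle⟩ := ih (by omega)
    have hne : Aᶜ.Nonempty := by
      rw [← Finset.card_pos, Finset.card_compl]
      omega
    obtain ⟨a, ha, hmin⟩ := Aᶜ.exists_min_image f hne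
    have ha' : a ∉ A := Finset.mem_compl.1 ha
    refine ⟨insert a A, by rw [Finset.card_insert_of_notMem ha', hA], fun i hi j hj => ?_⟩
    rw [Finset.mem_insert, not_or] at hj
    rcases Finset.mem_insert.1 hi with rfl | hi
    · exact hmin j (Finset.mem_compl.2 hj.2)
    · exact hle i hi j hj.2

/-- Any rate up to the fraction of the reliable bit-channels is attained by a polar code which uses
reliable bit-channels only. -/
theorem PolarScheme.exists_polarCode {n : ℕ} (s : PolarScheme n)
    (W : Fin (2 ^ n) → BinaryChannel.{u}) (τ : ℝ) {k : ℕ}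
    (hk : k ≤ (Finset.univ.filter fun i => (s.bitChannel W i).bhattacharyya ≤ τ).card) :
    ∃ C : PolarCode W, C.scheme = s ∧ C.info.card = k ∧
      ∀ i ∈ C.info, (s.bitChannel W i).bhattacharyya ≤ τ := by
  obtain ⟨A, hA, hle⟩ := exists_finset_card_eq_forall_le
    (fun i => (s.bitChannel W i).bhattacharyya) (hk.trans (Finset.card_le_univ _))
  refine ⟨⟨s, A, hle⟩, rfl, hA, fun i hi => ?_⟩
  by_contra hτ
  -- If an unreliable position `i` were chosen, every reliable one would have been chosen too,
  -- giving more than `k` positions.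
  have hsub : (Finset.univ.filter fun i => (s.bitChannel W i).bhattacharyya ≤ τ) ⊆ A.erase i := by
    intro j hj
    have hj := (Finset.mem_filter.1 hj).2
    refine Finset.mem_erase.2 ⟨fun h => hτ (h ▸ hj), ?_⟩
    by_contra hjA
    exact hτ ((hle i hi j hjA).trans hj)
  have := Finset.card_le_card hsub
  have h2 := Finset.card_erase_lt_of_mem (show i ∈ A from hi)
  omega

/-- The rate is aimed at `Ibar - ε / 2`, below the fraction of reliable bit-channels. Using only
some of them keeps the rate at most `Ibar` without an upper bound on their number. -/
theorem exists_polarCode_near_capacity (W : ℕ → BinaryChannel.{u}) (hW : ∀ j, (W j).IsSymmetric)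
    {Ibar : ℝ}
    (hI : Tendsto (fun N : ℕ => (1 / (N : ℝ)) * ∑ j ∈ Finset.range N, (W j).symmetricCapacity)
      atTop (𝓝 Ibar)) {ε : ℝ} (hε : 0 < ε) (m : ℕ) :
    ∃ (n : ℕ) (C : PolarCode (fun j : Fin (2 ^ n) => W j)), m ≤ n ∧ |C.rate - Ibar| ≤ ε ∧
      C.blockError ≤ ENNReal.ofReal ε := by
  have hlog := Real.log_pos one_lt_two
  have hI0 : 0 ≤ Ibar := ge_of_tendsto' hI fun N =>
    mul_nonneg (by positivity) (Finset.sum_nonneg fun j _ => (W j).symmetricCapacity_nonneg)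
  -- The first bound serves the block error; the second makes 2 / log 2 times the loss at most ε / 4
  -- of the length.
  set δ := min ε (ε * Real.log 2 / 8) with hδ
  have hδ0 : 0 < δ := lt_min hε (by positivity)
  obtain ⟨n₀, hn₀⟩ := PolarScheme.exists_loss_le_mul.{u} hδ0
  have hpow : Tendsto (fun n : ℕ => 2 ^ n) atTop atTop :=
    tendsto_pow_atTop_atTop_of_one_lt one_lt_two
  have hpowR : Tendsto (fun n : ℕ => (2 : ℝ) ^ n) atTop atTop :=
    tendsto_pow_atTop_atTop_of_one_lt one_lt_two
  -- The condition 2 / ε ≤ 2^n keeps the rounding of the number of information bits below ε / 2 in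
  -- rate.
  have hev := ((hI.comp hpow).eventually (lt_mem_nhds (show Ibar - ε / 4 < Ibar by linarith))).and
    ((hpowR.eventually_ge_atTop (2 / ε)).and ((eventually_ge_atTop n₀).and (eventually_ge_atTop m)))
  obtain ⟨n, hn, hn2, hn3, hn4⟩ := hev.exists
  set N : ℝ := 2 ^ n with hN
  have hN0 : 0 < N := by positivity
  obtain ⟨s, τ, hτ0, hτ, hloss⟩ := hn₀ n hn3 fun j => W j
  have hsum : N * (Ibar - ε / 4) ≤ ∑ j : Fin (2 ^ n), (W j).symmetricCapacity := by
    have h : Ibar - ε / 4 < 1 / ((2 ^ n : ℕ) : ℝ) *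
      ∑ j ∈ Finset.range (2 ^ n), (W j).symmetricCapacity := hn
    rw [Finset.sum_range] at h
    push_cast at h
    rw [one_div, inv_mul_eq_div, lt_div_iff₀ hN0] at h
    linarith
  have hcount := hsum.trans (s.sum_symmetricCapacity_le τ fun j => W j)
  set G := (Finset.univ.filter fun i =>
    (s.bitChannel (fun j : Fin (2 ^ n) => W j) i).bhattacharyya ≤ τ).card with hG
  have hl : 2 / Real.log 2 * s.loss τ (fun j : Fin (2 ^ n) => W j) ≤ ε / 4 * N := by
    have h1 : s.loss τ (fun j : Fin (2 ^ n) => W j) ≤ ε * Real.log 2 / 8 * N :=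
      hloss.trans (mul_le_mul_of_nonneg_right (min_le_right _ _) hN0.le)
    refine (mul_le_mul_of_nonneg_left h1 (by positivity)).trans_eq ?_
    field_simp
    norm_num
  have hG' : N * (Ibar - ε / 2) ≤ G := by linarith
  -- The maximum covers the case `Ibar < ε / 2`, where the target rate would be negative.
  set ρ := N * max 0 (Ibar - ε / 2) with hρ
  have hρ0 : 0 ≤ ρ := mul_nonneg hN0.le (le_max_left _ _)
  have hρG : ρ ≤ G := by
    rw [hρ, mul_max_of_nonneg _ _ hN0.le, mul_zero]
    exact max_le (Nat.cast_nonneg _) hG'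
  obtain ⟨C, hs, hcard, hC⟩ := s.exists_polarCode (fun j : Fin (2 ^ n) => W j) τ
    (Nat.floor_le_of_le hρG)
  have hfloor := Nat.floor_le hρ0
  refine ⟨n, C, hn4, ?_, ?_⟩
  · rw [PolarCode.rate, hcard, abs_le]
    constructor
    · have h1 := Nat.lt_floor_add_one ρ
      have h2 : N * (Ibar - ε / 2) ≤ ρ := mul_le_mul_of_nonneg_left (le_max_right _ _) hN0.le
      rw [div_le_iff₀ hε] at hn2
      rw [neg_le_sub_iff_le_add, ← sub_le_iff_le_add, le_div_iff₀ hN0]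
      linarith
    · have h1 : ρ ≤ N * Ibar :=
        mul_le_mul_of_nonneg_left (max_le hI0 (by linarith)) hN0.le
      have h2 : (⌊ρ⌋₊ : ℝ) / N ≤ Ibar := by
        rw [div_le_iff₀ hN0]
        linarith
      linarith
  · refine (C.blockError_le fun j => hW j).trans ?_
    rw [hs]
    calc ∑ i ∈ C.info, ENNReal.ofReal (s.bitChannel (fun j : Fin (2 ^ n) => W j) i).bhattacharyya
        ≤ ∑ _i ∈ C.info, ENNReal.ofReal τ :=
          Finset.sum_le_sum fun i hi => ENNReal.ofReal_le_ofReal (hC i hi)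
      _ = ENNReal.ofReal (C.info.card * τ) := by
          rw [Finset.sum_const, nsmul_eq_mul, ENNReal.ofReal_mul (Nat.cast_nonneg _),
            ENNReal.ofReal_natCast]
      _ ≤ ENNReal.ofReal ε := by
          refine ENNReal.ofReal_le_ofReal (le_trans ?_ (hτ.trans (min_le_left _ _)))
          refine mul_le_mul_of_nonneg_right ?_ hτ0
          have : C.info.card ≤ 2 ^ n := by simpa using Finset.card_le_univ C.info
          exact_mod_cast this

end

theorem mainTheorem3 (W : ℕ → BinaryChannel.{u}) (hW : ∀ j, (W j).IsSymmetric) (Ibar : ℝ)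
    (hI : Tendsto (fun N : ℕ => (1 / (N : ℝ)) * ∑ j ∈ Finset.range N, (W j).symmetricCapacity)
      atTop (𝓝 Ibar)) :
    ∃ (n : ℕ → ℕ) (C : ∀ i : ℕ, PolarCode (fun j : Fin (2 ^ n i) => W j)) (t : ℕ → ℕ),
      Tendsto n atTop atTop ∧
      (∀ i, (C i).DecodableIn (t i)) ∧
      (fun i => (t i : ℝ)) =O[atTop] (fun i => (2 : ℝ) ^ n i * Real.log ((2 : ℝ) ^ n i)) ∧
      Tendsto (fun i => (C i).rate) atTop (𝓝 Ibar) ∧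
      Tendsto (fun i => (C i).blockError) atTop (𝓝 0) := by
  choose n C hn hrate herr using fun i : ℕ =>
    exists_polarCode_near_capacity W hW hI (Nat.one_div_pos_of_nat (α := ℝ) (n := i)) i
  have hntop : Tendsto n atTop atTop := tendsto_atTop_mono hn tendsto_id
  refine ⟨n, C, fun i => (1 + 13 * n i) * 2 ^ n i, hntop, fun i => (C i).decodableIn, ?_, ?_, ?_⟩
  -- For `n i ≥ 1` one has 1 + 13 n ≤ 14 n, and log 2^n = n log 2.
  · refine Asymptotics.IsBigO.of_bound (14 / Real.log 2) ?_
    filter_upwards [hntop.eventually_ge_atTop 1] with i hi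
    have hlog := Real.log_pos one_lt_two
    have hi' : (1 : ℝ) ≤ n i := by exact_mod_cast hi
    rw [Real.log_pow, Real.norm_of_nonneg (by positivity), Real.norm_of_nonneg (by positivity)]
    push_cast
    have e : 14 / Real.log 2 * (2 ^ n i * (n i * Real.log 2)) = 14 * n i * 2 ^ n i := by
      field_simp
    rw [e]
    exact mul_le_mul_of_nonneg_right (by linarith) (by positivity)
  · rw [tendsto_iff_norm_sub_tendsto_zero]
    exact squeeze_zero (fun _ => norm_nonneg _) hrate tendsto_one_div_add_atTop_nhds_zero_nat
  · refine tendsto_of_tendsto_of_tendsto_of_le_of_le tendsto_const_nhds ?_ (fun _ => zero_le) herr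
    simpa using ENNReal.tendsto_ofReal (tendsto_one_div_add_atTop_nhds_zero_nat (𝕜 := ℝ))
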